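/- Let $A$ and $B$ be Lie algebroids on the same smooth manifold $M$, with anchors $a\colon A\to TM$ and $b\colon B\to TM$. Let $\rho$ be a representation of $A$ on the vector bundle underlying $B$, and $\sigma$ a representation of $B$ on the vector bundle underlying $A$. (A representation $\rho$ of $A$ on a vector bundle $W$ is a Lie algebroid morphism $A\to\mathrm{CDO}(W)$ over $M$. Equivalently, it is an $\mathbb R$-bilinear map $(X,w)\mapsto\rho_X(w)$, $\Gamma A\times\Gamma W\to\Gamma W$, with $\rho_{fX}(w)=f\rho_X(w)$, $\rho_X(fw)=f\rho_X(w)+a(X)(f)\,w$ and $\rho_{[X_1,X_2]}=\rho_{X_1}\rho_{X_2}-\rho_{X_2}\rho_{X_1}$.) $A$ and $B$ form a matched pair with respect to $\rho$ and $\sigma$ if, for all $X,X_1,X_2\in\Gamma A$ and $Y,Y_1,Y_2\in\Gamma B$, $$\rho_X([Y_1,Y_2])=[\rho_X(Y_1),Y_2]+[Y_1,\rho_X(Y_2)]+\rho_{\sigma_{Y_2}(X)}(Y_1)-\rho_{\sigma_{Y_1}(X)}(Y_2),$$ $$\sigma_Y([X_1,X_2])=[\sigma_Y(X_1),X_2]+[X_1,\sigma_Y(X_2)]+\sigma_{\rho_{X_2}(Y)}(X_1)-\sigma_{\rho_{X_1}(Y)}(X_2),$$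 $$a(\sigma_Y(X))-b(\rho_X(Y))=[b(Y),a(X)].$$ Let $\rho^{(*)}$ on $B^*$ and $\sigma^{(*)}$ on $A^*$ be the contragredient representations, defined by $$\langle\rho^{(*)}_X(\psi),Y\rangle=a(X)\langle\psi,Y\rangle-\langle\psi,\rho_X(Y)\rangle,\qquad \langle\sigma^{(*)}_Y(\phi),X\rangle=b(Y)\langle\phi,X\rangle-\langle\phi,\sigma_Y(X)\rangle.$$ Let $E=A\ltimes B^*$ be the Lie algebroid on the vector bundle $A\oplus B^*$ with anchor $e(X\oplus\psi)=a(X)$ and bracket $$[X_1\oplus\psi_1,X_2\oplus\psi_2]=[X_1,X_2]\oplus\{\rho^{(*)}_{X_1}(\psi_2)-\rho^{(*)}_{X_2}(\psi_1)\}.$$ Let $\overline{A^*\rtimes B}$, the opposite of the semidirect product $A^*\rtimes B$, be the Lie algebroid on $A^*\oplus B$ with anchor $e_*(\phi\oplus Y)=-b(Y)$ and bracket $$[\phi_1\oplus Y_1,\phi_2\oplus Y_2]=\{\sigma^{(*)}_{Y_2}(\phi_1)-\sigma^{(*)}_{Y_1}(\phi_2)\}\oplus[Y_2,Y_1].$$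 Identify $A^*\oplus B$ with the dual bundle $E^*$ through the pairing $\langle X+\psi,\phi+Y\rangle=\langle\phi,X\rangle-\langle\psi,Y\rangle$. Then $A$ and $B$ form a matched pair with respect to $\rho$ and $\sigma$ if and only if $(A\ltimes B^*,\overline{A^*\rtimes B})$ is a Lie bialgebroid, that is, if and only if $$d^E[\xi,\eta]=[d^E\xi,\eta]+[\xi,d^E\eta]\qquad\text{for all }\xi,\eta\in\Gamma E^*.$$ Here the bracket $[\xi,\eta]$ is that of $\overline{A^*\rtimes B}$, the operator $d^E\colon\Gamma E^*\to\Gamma\Lambda^2E^*$ is the Lie algebroid differential of $E=A\ltimes B^*$, $$(d^E\xi)(u,v)=e(u)\langle v,\xi\rangle-e(v)\langle u,\xi\rangle-\langle[u,v],\xi\rangle\qquad(u,v\in\Gamma E),$$ and the brackets on the right are Schouten brackets for $\overline{A^*\rtimes B}$: for $\xi\in\Gamma E^*$ and $\omega\in\Gamma\Lambda^2E^*$, $[\xi,\omega]=-[\omega,\xi]$ is the derivation extension of $[\xi,-]$ to $\Gamma\Lambda^2E^*$, i.e. the Lie derivative of $\omega$ along $\xi$. -/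

import Mathlib

open Bundle Set Filter
open scoped Manifold ContDiff Topology

set_option linter.unusedSectionVars false

noncomputable section

namespace LieAlgebroids

section VectorFields

variable {E : Type*} [NormedAddCommGroup E] [NormedSpace ℝ E]
  {H : Type*} [TopologicalSpace H] {I : ModelWithCorners ℝ E H}
  {M : Type*} [TopologicalSpace M] [ChartedSpace H M]

/-- The derivative `v(f)` of a real-valued function `f` on `M` along a tangent vector `v` at `x`. -/
def dirDeriv (I : ModelWithCorners ℝ E H) (f : M → ℝ) (x : M) (v : TangentSpace I x) : ℝ :=
  mfderiv I 𝓘(ℝ, ℝ) f x v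

theorem dirDeriv_add_right (f : M → ℝ) (x : M) (v w : TangentSpace I x) :
    dirDeriv I f x (v + w) = dirDeriv I f x v + dirDeriv I f x w :=
  map_add (mfderiv I 𝓘(ℝ, ℝ) f x) v w

theorem dirDeriv_smul_right (f : M → ℝ) (x : M) (c : ℝ) (v : TangentSpace I x) :
    dirDeriv I f x (c • v) = c * dirDeriv I f x v :=
  map_smul (mfderiv I 𝓘(ℝ, ℝ) f x) c v

theorem dirDeriv_neg_right (f : M → ℝ) (x : M) (v : TangentSpace I x) :
    dirDeriv I f x (-v) = -dirDeriv I f x v :=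
  map_neg (mfderiv I 𝓘(ℝ, ℝ) f x) v

theorem dirDeriv_add_left {f g : M → ℝ} {x : M} (hf : MDifferentiableAt I 𝓘(ℝ, ℝ) f x)
    (hg : MDifferentiableAt I 𝓘(ℝ, ℝ) g x) (v : TangentSpace I x) :
    dirDeriv I (fun y => f y + g y) x v = dirDeriv I f x v + dirDeriv I g x v := by
  have := (hf.hasMFDerivAt.add hg.hasMFDerivAt).mfderiv
  exact congrArg (fun L : TangentSpace I x →L[ℝ] ℝ => L v) this

theorem dirDeriv_mul_left {f g : M → ℝ} {x : M} (hf : MDifferentiableAt I 𝓘(ℝ, ℝ) f x)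
    (hg : MDifferentiableAt I 𝓘(ℝ, ℝ) g x) (v : TangentSpace I x) :
    dirDeriv I (fun y => f y * g y) x v = f x * dirDeriv I g x v + dirDeriv I f x v * g x := by
  have := (hf.hasMFDerivAt.mul hg.hasMFDerivAt).mfderiv
  have h2 := congrArg (fun L : TangentSpace I x →L[ℝ] ℝ => L v) this
  refine h2.trans ?_
  show f x * dirDeriv I g x v + g x * dirDeriv I f x v = _
  ring

variable [IsManifold I ∞ M]

theorem contMDiff_dirDeriv {f : M → ℝ} (hf : ContMDiff I 𝓘(ℝ, ℝ) ∞ f)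
    {X : ∀ x : M, TangentSpace I x}
    (hX : ContMDiff I (I.prod 𝓘(ℝ, E)) ∞ (fun x => TotalSpace.mk' E x (X x))) :
    ContMDiff I 𝓘(ℝ, ℝ) ∞ (fun x => dirDeriv I f x (X x)) := by
  have h1 := (hf.contMDiff_tangentMap (m := ∞) (by simp)).comp hX
  exact (contMDiff_snd_tangentBundle_modelSpace ℝ 𝓘(ℝ, ℝ)).comp h1

theorem fderivWithin_mpullbackWithin_eventuallyEq {f : M → ℝ} (hf : ContMDiff I 𝓘(ℝ, ℝ) ∞ f)
    (V : ∀ x : M, TangentSpace I x) (x : M) :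
    (fun y => fderivWithin ℝ (f ∘ (extChartAt I x).symm) (range I) y
      (VectorField.mpullbackWithin 𝓘(ℝ, E) I (extChartAt I x).symm V (range I) y))
     =ᶠ[𝓝[range I] (extChartAt I x x)]
     (fun y => dirDeriv I f y (V y)) ∘ (extChartAt I x).symm := by
  filter_upwards [extChartAt_target_mem_nhdsWithin (I := I) x] with y hy
  have hu : UniqueMDiffWithinAt 𝓘(ℝ, E) (range I) y :=
    I.uniqueMDiffOn _ (extChartAt_target_subset_range x hy)
  have hs : MDifferentiableWithinAt 𝓘(ℝ, E) I (extChartAt I x).symm (range I) y :=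
    (contMDiffWithinAt_extChartAt_symm_range (n := 1) x hy).mdifferentiableWithinAt one_ne_zero
  have hc := mfderivWithin_comp y (s := range I) (u := univ) (I := 𝓘(ℝ, E)) (I' := I)
    (I'' := 𝓘(ℝ, ℝ)) (g := f) (f := (extChartAt I x).symm)
    ((hf.mdifferentiable (by simp)) _).mdifferentiableWithinAt hs (by simp) hu
  rw [mfderivWithin_univ] at hc
  rw [← mfderivWithin_eq_fderivWithin, hc, VectorField.mpullbackWithin_apply]
  have := (isInvertible_mfderivWithin_extChartAt_symm (I := I) hy).self_apply_inverse
    (V ((extChartAt I x).symm y))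
  exact congrArg (mfderiv I 𝓘(ℝ, ℝ) f ((extChartAt I x).symm y)) this

/-- The Lie bracket of vector fields acts on functions as the commutator of derivations. -/
theorem dirDeriv_mlieBracket [CompleteSpace E] {f : M → ℝ} (hf : ContMDiff I 𝓘(ℝ, ℝ) ∞ f)
    {V W : ∀ x : M, TangentSpace I x}
    (hV : ContMDiff I (I.prod 𝓘(ℝ, E)) ∞ (fun x => TotalSpace.mk' E x (V x)))
    (hW : ContMDiff I (I.prod 𝓘(ℝ, E)) ∞ (fun x => TotalSpace.mk' E x (W x))) (x : M) :
    dirDeriv I f x (VectorField.mlieBracket I V W x) =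
      dirDeriv I (fun y => dirDeriv I f y (W y)) x (V x) -
      dirDeriv I (fun y => dirDeriv I f y (V y)) x (W x) := by
  have hM {g : M → ℝ} (hg : ContMDiff I 𝓘(ℝ, ℝ) ∞ g) (v : TangentSpace I x) :
      dirDeriv I g x v =
      fderivWithin ℝ (g ∘ (extChartAt I x).symm) (range I) (extChartAt I x x) v := by
    rw [dirDeriv, ((hg.mdifferentiable (by simp)) x).mfderiv]
    rfl
  have hval (V : ∀ x : M, TangentSpace I x) :
      VectorField.mpullbackWithin 𝓘(ℝ, E) I (extChartAt I x).symm V (range I) (extChartAt I x x)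
       = V x := by
    have hinv : (mfderivWithin 𝓘(ℝ, E) I (extChartAt I x).symm (range I)
        (extChartAt I x x) : E →L[ℝ] E).inverse = ContinuousLinearMap.id ℝ E :=
      (congrArg (fun L : E →L[ℝ] E => L.inverse) mfderivWithin_range_extChartAt_symm).trans
        ContinuousLinearMap.inverse_id
    refine (congrArg (fun L : E →L[ℝ] E =>
      L (V ((extChartAt I x).symm (extChartAt I x x)) : E)) hinv).trans ?_
    have h : (extChartAt I x).symm (extChartAt I x x) = x := extChartAt_to_inv x
    have : ∀ y : M, y = x → (V y : E) = V x := by rintro y rfl; rfl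
    exact this _ h
  have hd {V : ∀ x : M, TangentSpace I x}
      (hV : ContMDiff I (I.prod 𝓘(ℝ, E)) ∞ (fun x => TotalSpace.mk' E x (V x))) :
      DifferentiableWithinAt ℝ
        (VectorField.mpullbackWithin 𝓘(ℝ, E) I (extChartAt I x).symm V (range I))
        (range I) (extChartAt I x x) := by
    have := ((hV.mdifferentiable (by simp) x).mdifferentiableWithinAt
      (s := univ)).differentiableWithinAt_mpullbackWithin_vectorField
    simpa using this
  have hb : VectorField.mlieBracket I V W x = VectorField.lieBracketWithin ℝ
      (VectorField.mpullbackWithin 𝓘(ℝ, E) I (extChartAt I x).symm V (range I))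
      (VectorField.mpullbackWithin 𝓘(ℝ, E) I (extChartAt I x).symm W (range I)) (range I)
      (extChartAt I x x) := by
    rw [← VectorField.mlieBracketWithin_univ, VectorField.mlieBracketWithin_apply,
      preimage_univ, univ_inter]
    have hinv : (mfderiv I 𝓘(ℝ, E) (extChartAt I x) x : E →L[ℝ] E).inverse =
        ContinuousLinearMap.id ℝ E :=
      (congrArg (fun L : E →L[ℝ] E => L.inverse) mfderiv_extChartAt_self).trans
        ContinuousLinearMap.inverse_id
    exact congrArg (fun L : E →L[ℝ] E => L _) hinv
  have hg : ContDiffWithinAt ℝ ∞ (f ∘ (extChartAt I x).symm) (range I) (extChartAt I x x) := by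
    exact (contMDiffAt_iff.1 (hf x)).2
  have h1 := VectorField.fderivWithin_apply_lieBracket (n := 2)
    (hg.of_le (by norm_cast)) (by simp) I.uniqueDiffOn
    (I.range_subset_closure_interior (mem_range_self _)) (mem_range_self _) (hd hW) (hd hV)
  rw [hval, hval, (fderivWithin_mpullbackWithin_eventuallyEq hf V x).fderivWithin_eq_of_mem
    (mem_range_self _), (fderivWithin_mpullbackWithin_eventuallyEq hf W x).fderivWithin_eq_of_mem
    (mem_range_self _)] at h1
  rw [hM hf, hM (contMDiff_dirDeriv hf hW), hM (contMDiff_dirDeriv hf hV), hb]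
  exact h1

end VectorFields

section Sections

variable {E : Type*} [NormedAddCommGroup E] [NormedSpace ℝ E]
  {H : Type*} [TopologicalSpace H] {I : ModelWithCorners ℝ E H}
  {M : Type*} [TopologicalSpace M] [ChartedSpace H M]
  {F : Type*} [NormedAddCommGroup F] [NormedSpace ℝ F]
  {V : M → Type*} [TopologicalSpace (TotalSpace F V)] [∀ x, AddCommGroup (V x)]
  [∀ x, Module ℝ (V x)] [∀ x, TopologicalSpace (V x)] [FiberBundle F V] [VectorBundle ℝ F V]

/-- Pointwise multiplication of a smooth section by a smooth function. -/
instance : SMul C^∞⟮I, M; ℝ⟯ Cₛ^∞⟮I; F, V⟯ :=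
  ⟨fun f s => ⟨fun x => f x • s x, ContMDiff.smul_section f.contMDiff s.contMDiff⟩⟩

@[simp]
theorem smul_section_apply (f : C^∞⟮I, M; ℝ⟯) (s : Cₛ^∞⟮I; F, V⟯) (x : M) :
    (f • s) x = f x • s x := rfl

theorem add_section_apply (s t : Cₛ^∞⟮I; F, V⟯) (x : M) : (s + t) x = s x + t x := rfl

theorem zero_section_apply (x : M) : (0 : Cₛ^∞⟮I; F, V⟯) x = 0 := rfl

variable [FiniteDimensional ℝ E] [IsManifold I ∞ M] [T2Space M] [FiniteDimensional ℝ F]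
  [ContMDiffVectorBundle ∞ F V I]

theorem sum_section_apply {ι : Type*} (t : Finset ι) (s : ι → Cₛ^∞⟮I; F, V⟯) (x : M) :
    (∑ i ∈ t, s i) x = ∑ i ∈ t, s i x := by
  have h := congrFun (map_sum (ContMDiffSection.coeAddHom I F ∞ V) s t) x
  rwa [Finset.sum_apply] at h

/-- Near every point there is a local frame consisting of global sections, in which every section
can be expanded after multiplication by a cut-off function. -/
theorem exists_frame (I : ModelWithCorners ℝ E H) [IsManifold I ∞ M] [ContMDiffVectorBundle ∞ F V I]
    (x₀ : M) :
    ∃ G : Module.Basis.ofVectorSpaceIndex ℝ F → Cₛ^∞⟮I; F, V⟯,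
      (∀ᶠ x in 𝓝 x₀, ∃ b : Module.Basis (Module.Basis.ofVectorSpaceIndex ℝ F) ℝ (V x),
        ∀ i, b i = G i x) ∧
      ∀ s : Cₛ^∞⟮I; F, V⟯, ∃ (χ : C^∞⟮I, M; ℝ⟯)
        (a : Module.Basis.ofVectorSpaceIndex ℝ F → C^∞⟮I, M; ℝ⟯),
        χ x₀ = 1 ∧ χ • s = ∑ i, a i • G i := by
  let e := trivializationAt F V x₀
  let b := Module.Basis.ofVectorSpace ℝ F
  have hx₀ : x₀ ∈ e.baseSet := FiberBundle.mem_baseSet_trivializationAt F V x₀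
  obtain ⟨ψ, -, hψ⟩ := (SmoothBumpFunction.nhds_basis_tsupport (I := I) x₀).mem_iff.1
    (e.open_baseSet.mem_nhds hx₀)
  have hψ' : ContMDiff I 𝓘(ℝ, ℝ) ∞ ψ := ψ.contMDiff
  let G : Module.Basis.ofVectorSpaceIndex ℝ F → Cₛ^∞⟮I; F, V⟯ := fun i =>
    ⟨fun x => ψ x • e.localFrame b i x,
      ContMDiffOn.smul_section_of_tsupport hψ'.contMDiffOn e.open_baseSet hψ
        (e.contMDiffOn_localFrame_baseSet ∞ b i)⟩
  refine ⟨G, ?_, fun s => ?_⟩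
  · filter_upwards [ψ.eventuallyEq_one, e.open_baseSet.mem_nhds hx₀] with x h1 hx
    refine ⟨e.basisAt b hx, fun i => ?_⟩
    show _ = ψ x • e.localFrame b i x
    rw [h1, e.localFrame_apply_of_mem_baseSet b hx]
    simp
  · have ha : ∀ i, ContMDiff I 𝓘(ℝ, ℝ) ∞ (fun x => ψ x • e.localFrameCoeff I b i x (s x)) := by
      intro i
      have h1 := contMDiffOn_baseSet_localFrameCoeff (e := e) b (k := ∞)
        (s.contMDiff.contMDiffOn (s := e.baseSet)) i
      refine contMDiff_of_tsupport fun x hx => ?_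
      have hx' : x ∈ e.baseSet := hψ (tsupport_smul_subset_left _ _ hx)
      exact (hψ' x).smul ((h1 x hx').contMDiffAt (e.open_baseSet.mem_nhds hx'))
    refine ⟨⟨fun x => ψ x * ψ x, hψ'.mul hψ'⟩, fun i => ⟨_, ha i⟩, ?_, ?_⟩
    · show ψ x₀ * ψ x₀ = 1
      rw [ψ.eq_one, one_mul]
    · ext x
      rw [sum_section_apply]
      show (ψ x * ψ x) • s x = ∑ i, (ψ x • e.localFrameCoeff I b i x (s x)) •
        (ψ x • e.localFrame b i x)
      by_cases hx : x ∈ e.baseSet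
      · have := e.eq_sum_localFrameCoeff_smul (I := I) (b := b) (s := s) hx
        conv_lhs => rw [this]
        rw [Finset.smul_sum]
        refine Finset.sum_congr rfl fun i _ => ?_
        simp only [smul_smul, smul_eq_mul]
        congr 1
        ring
      · have : ψ x = 0 := by
          by_contra h
          exact hx (hψ (subset_tsupport _ h))
        simp [this]

end Sections

section Pairings

variable {E : Type*} [NormedAddCommGroup E] [NormedSpace ℝ E]
  {H : Type*} [TopologicalSpace H] {I : ModelWithCorners ℝ E H}
  {M : Type*} [TopologicalSpace M] [ChartedSpace H M]
  {F : Type*} [NormedAddCommGroup F] [NormedSpace ℝ F]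
  {V : M → Type*} [TopologicalSpace (TotalSpace F V)] [∀ x, AddCommGroup (V x)]
  [∀ x, Module ℝ (V x)] [∀ x, TopologicalSpace (V x)] [FiberBundle F V] [VectorBundle ℝ F V]
  {F' : Type*} [NormedAddCommGroup F'] [NormedSpace ℝ F']
  {W : M → Type*} [TopologicalSpace (TotalSpace F' W)] [∀ x, AddCommGroup (W x)]
  [∀ x, Module ℝ (W x)] [∀ x, TopologicalSpace (W x)] [FiberBundle F' W] [VectorBundle ℝ F' W]

variable (I F V F' W) in
/-- A smooth perfect pairing of two vector bundles over the same base; it identifies each of the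
two bundles with the dual of the other one. -/
structure BundlePairing where
  /-- The pairing of the fibres. -/
  toFun : ∀ x, V x →ₗ[ℝ] W x →ₗ[ℝ] ℝ
  smooth : ∀ (s : Cₛ^∞⟮I; F, V⟯) (t : Cₛ^∞⟮I; F', W⟯),
    ContMDiff I 𝓘(ℝ, ℝ) ∞ (fun x => toFun x (s x) (t x))
  perfect : ∀ x, (toFun x).IsPerfPair

/-- The pairing `⟨s, t⟩` of sections, a smooth function on the base. -/
def BundlePairing.pair (P : BundlePairing I F V F' W) (s : Cₛ^∞⟮I; F, V⟯)
    (t : Cₛ^∞⟮I; F', W⟯) : C^∞⟮I, M; ℝ⟯ :=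
  ⟨fun x => P.toFun x (s x) (t x), P.smooth s t⟩

@[simp]
theorem BundlePairing.pair_apply (P : BundlePairing I F V F' W) (s : Cₛ^∞⟮I; F, V⟯)
    (t : Cₛ^∞⟮I; F', W⟯) (x : M) : P.pair s t x = P.toFun x (s x) (t x) := rfl

variable [FiniteDimensional ℝ E] [IsManifold I ∞ M] [T2Space M]
  [FiniteDimensional ℝ F] [ContMDiffVectorBundle ∞ F V I]
  [FiniteDimensional ℝ F'] [ContMDiffVectorBundle ∞ F' W I]

theorem functional_sum {Φ : Cₛ^∞⟮I; F', W⟯ → C^∞⟮I, M; ℝ⟯}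
    (hadd : ∀ s t, Φ (s + t) = Φ s + Φ t) (hsmul : ∀ (f : C^∞⟮I, M; ℝ⟯) s, Φ (f • s) = f * Φ s)
    {ι : Type*} (t : Finset ι) (a : ι → C^∞⟮I, M; ℝ⟯) (G : ι → Cₛ^∞⟮I; F', W⟯) (x : M) :
    Φ (∑ i ∈ t, a i • G i) x = ∑ i ∈ t, a i x * Φ (G i) x := by
  classical
  have h0 : Φ 0 = 0 := by
    have := hadd 0 0
    rw [add_zero] at this
    exact left_eq_add.1 this
  induction t using Finset.induction_on with
  | empty =>
    rw [Finset.sum_empty, Finset.sum_empty, h0]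
    rfl
  | insert j t hj ih =>
    rw [Finset.sum_insert hj, Finset.sum_insert hj, hadd, hsmul, ← ih]
    rfl

/-- A functional on sections which is linear over the smooth functions acts fibrewise. -/
theorem exists_fibre_functional {Φ : Cₛ^∞⟮I; F', W⟯ → C^∞⟮I, M; ℝ⟯}
    (hadd : ∀ s t, Φ (s + t) = Φ s + Φ t) (hsmul : ∀ (f : C^∞⟮I, M; ℝ⟯) s, Φ (f • s) = f * Φ s)
    (x : M) : ∃ φ : Module.Dual ℝ (W x), ∀ t, φ (t x) = Φ t x := by
  obtain ⟨G, hG, hexp⟩ := exists_frame (F := F') (V := W) I x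
  obtain ⟨b, hb⟩ := hG.self_of_nhds
  refine ⟨b.constr ℝ fun i => Φ (G i) x, fun t => ?_⟩
  obtain ⟨χ, a, hχ, ha⟩ := hexp t
  have h1 : t x = ∑ i, a i x • b i := by
    have := congrArg (fun s : Cₛ^∞⟮I; F', W⟯ => s x) ha
    simp only [smul_section_apply, hχ, one_smul, sum_section_apply] at this
    simp only [this, hb]
  have h2 : Φ t x = ∑ i, a i x * Φ (G i) x := by
    rw [← functional_sum hadd hsmul, ← ha, hsmul]
    show _ = χ x * Φ t x
    rw [hχ, one_mul]
  rw [h1, h2, map_sum]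
  refine Finset.sum_congr rfl fun i _ => ?_
  rw [map_smul, Module.Basis.constr_basis, smul_eq_mul]

/-- A functional on the sections of `W` which is linear over the smooth functions is the pairing
with a unique smooth section of the bundle `V` in duality with `W`. -/
theorem BundlePairing.existsUnique_section (P : BundlePairing I F V F' W)
    {Φ : Cₛ^∞⟮I; F', W⟯ → C^∞⟮I, M; ℝ⟯}
    (hadd : ∀ s t, Φ (s + t) = Φ s + Φ t)
    (hsmul : ∀ (f : C^∞⟮I, M; ℝ⟯) s, Φ (f • s) = f * Φ s) :
    ∃! s : Cₛ^∞⟮I; F, V⟯, ∀ t, P.pair s t = Φ t := by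
  classical
  choose φ hφ using exists_fibre_functional hadd hsmul
  have hperf := P.perfect
  choose v hv using fun x => (hperf x).bijective_left.2 (φ x)
  have hv' : ∀ x t, P.toFun x (v x) (t x) = Φ t x := fun x t => by rw [hv x, hφ]
  have hsep : ∀ x (u u' : V x), (∀ t : Cₛ^∞⟮I; F', W⟯, P.toFun x u (t x) = P.toFun x u' (t x)) →
      u = u' := by
    intro x u u' h
    obtain ⟨G, hG, -⟩ := exists_frame (F := F') (V := W) I x
    obtain ⟨b, hb⟩ := hG.self_of_nhds
    refine (hperf x).bijective_left.1 (b.ext fun i => ?_)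
    rw [hb]
    exact h (G i)
  have hsmooth : ContMDiff I (I.prod 𝓘(ℝ, F)) ∞ (fun x => TotalSpace.mk' F x (v x)) := by
    intro x₀
    obtain ⟨A, hA, -⟩ := exists_frame (F := F) (V := V) I x₀
    obtain ⟨B, hB, -⟩ := exists_frame (F := F') (V := W) I x₀
    -- the Gram matrix of the two local frames, as a family of linear maps
    let L : Module.Basis.ofVectorSpaceIndex ℝ F → Module.Basis.ofVectorSpaceIndex ℝ F' →
        ((Module.Basis.ofVectorSpaceIndex ℝ F → ℝ) →L[ℝ]
          (Module.Basis.ofVectorSpaceIndex ℝ F' → ℝ)) := fun i j =>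
      (ContinuousLinearMap.proj (R := ℝ) (φ := fun _ => ℝ) i).smulRight (Pi.single j (1 : ℝ))
    let N : M → ((Module.Basis.ofVectorSpaceIndex ℝ F → ℝ) →L[ℝ]
        (Module.Basis.ofVectorSpaceIndex ℝ F' → ℝ)) := fun y =>
      ∑ i, ∑ j, (P.toFun y (A i y) (B j y)) • L i j
    have hN_apply : ∀ y c j, N y c j = P.toFun y (∑ i, c i • A i y) (B j y) := by
      intro y c j
      simp only [N, L, sum_apply, smul_apply,
        ContinuousLinearMap.smulRight_apply, ContinuousLinearMap.proj_apply, Finset.sum_apply,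
        Pi.smul_apply, smul_eq_mul, map_sum, map_smul, LinearMap.sum_apply,
        LinearMap.smul_apply]
      refine Finset.sum_congr rfl fun i _ => ?_
      rw [Finset.sum_eq_single (M := ℝ) j]
      · simp [mul_comm]
      · intro k _ hk
        simp [hk.symm]
      · simp
    have hN_smooth : ContMDiff I 𝓘(ℝ, (Module.Basis.ofVectorSpaceIndex ℝ F → ℝ) →L[ℝ]
        (Module.Basis.ofVectorSpaceIndex ℝ F' → ℝ)) ∞ N :=
      contMDiff_finsetSum fun i _ => contMDiff_finsetSum fun j _ =>
        (P.smooth (A i) (B j)).smul contMDiff_const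
    have hN_equiv : ∀ᶠ y in 𝓝 x₀, ∃ e : (Module.Basis.ofVectorSpaceIndex ℝ F → ℝ) ≃L[ℝ]
        (Module.Basis.ofVectorSpaceIndex ℝ F' → ℝ), (e : _ →L[ℝ] _) = N y := by
      filter_upwards [hA, hB] with y ⟨α, hα⟩ ⟨β, hβ⟩
      have hbij : Function.Bijective (N y).toLinearMap := by
        constructor
        · rw [← LinearMap.ker_eq_bot, LinearMap.ker_eq_bot']
          intro c hc
          have h0 : ∑ i, c i • A i y = 0 := by
            refine (hperf y).bijective_left.1 (β.ext fun j => ?_)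
            rw [hβ, ← hN_apply y c j]
            simpa using congrFun hc j
          simp only [← hα] at h0
          exact funext (Fintype.linearIndependent_iff.1 α.linearIndependent c h0)
        · intro d
          obtain ⟨u, hu⟩ := (hperf y).bijective_left.2 (β.constr ℝ d)
          refine ⟨fun i => α.repr u i, funext fun j => ?_⟩
          show N y _ j = d j
          rw [hN_apply]
          simp only [← hα, ← hβ]
          rw [α.sum_repr, hu, Module.Basis.constr_basis]
      refine ⟨(LinearEquiv.ofBijective (N y).toLinearMap hbij).toContinuousLinearEquiv, ?_⟩
      ext c j
      rfl
    let h : M → (Module.Basis.ofVectorSpaceIndex ℝ F' → ℝ) := fun y j => Φ (B j) y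
    have hh : ContMDiff I 𝓘(ℝ, Module.Basis.ofVectorSpaceIndex ℝ F' → ℝ) ∞ h :=
      contMDiff_pi_space.2 fun j => (Φ (B j)).contMDiff
    let c : M → (Module.Basis.ofVectorSpaceIndex ℝ F → ℝ) := fun y => (N y).inverse (h y)
    have hc : ContMDiffAt I 𝓘(ℝ, Module.Basis.ofVectorSpaceIndex ℝ F → ℝ) ∞ c x₀ := by
      obtain ⟨e, he⟩ := hN_equiv.self_of_nhds
      have hinv : ContDiffAt ℝ ∞ ContinuousLinearMap.inverse (N x₀) :=
        he ▸ contDiffAt_map_inverse e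
      exact ContMDiffAt.clm_apply (hinv.contMDiffAt.comp x₀ (hN_smooth x₀)) (hh x₀)
    have hvc : ∀ᶠ y in 𝓝 x₀, v y = ∑ i, c y i • A i y := by
      filter_upwards [hA, hN_equiv] with y ⟨α, hα⟩ ⟨e, he⟩
      have h1 : N y (fun i => α.repr (v y) i) = h y := by
        funext j
        rw [hN_apply]
        simp only [← hα]
        rw [α.sum_repr, hv']
      have h2 : c y = fun i => α.repr (v y) i := by
        show (N y).inverse (h y) = _
        rw [← h1, ← he, ContinuousLinearMap.inverse_equiv]
        exact e.symm_apply_apply _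
      rw [h2]
      simp only [← hα]
      exact (α.sum_repr (v y)).symm
    have hs : ContMDiffAt I (I.prod 𝓘(ℝ, F)) ∞
        (fun y => TotalSpace.mk' F y (∑ i, c y i • A i y)) x₀ :=
      ContMDiffAt.sum_section fun i _ =>
        ContMDiffAt.smul_section (contMDiffAt_pi_space.1 hc i) (A i).contMDiff.contMDiffAt
    refine hs.congr_of_eventuallyEq ?_
    filter_upwards [hvc] with y hy
    rw [hy]
  refine ⟨⟨v, hsmooth⟩, fun t => ?_, fun s hs => ?_⟩
  · ext x
    exact hv' x t
  · ext x
    refine hsep x _ _ fun t => ?_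
    have := congrArg (fun f : C^∞⟮I, M; ℝ⟯ => f x) (hs t)
    exact this.trans (hv' x t).symm

end Pairings

section Definitions

variable {E : Type*} [NormedAddCommGroup E] [NormedSpace ℝ E]
  {H : Type*} [TopologicalSpace H] {I : ModelWithCorners ℝ E H}
  {M : Type*} [TopologicalSpace M] [ChartedSpace H M]
  {F : Type*} [NormedAddCommGroup F] [NormedSpace ℝ F]
  {V : M → Type*} [TopologicalSpace (TotalSpace F V)] [∀ x, AddCommGroup (V x)]
  [∀ x, Module ℝ (V x)] [∀ x, TopologicalSpace (V x)] [FiberBundle F V] [VectorBundle ℝ F V]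
  {F' : Type*} [NormedAddCommGroup F'] [NormedSpace ℝ F']
  {W : M → Type*} [TopologicalSpace (TotalSpace F' W)] [∀ x, AddCommGroup (W x)]
  [∀ x, Module ℝ (W x)] [∀ x, TopologicalSpace (W x)] [FiberBundle F' W] [VectorBundle ℝ F' W]
  [IsManifold I ∞ M]

variable (I F V) in
/-- An anchor on a vector bundle `V`: a smooth morphism of vector bundles `V → TM` over the identity
of `M`. -/
structure Anchor where
  /-- The anchor map on the fibres. -/
  anchor : ∀ x, V x →ₗ[ℝ] TangentSpace I x
  anchor_smooth : ContMDiff (I.prod 𝓘(ℝ, F)) (I.prod 𝓘(ℝ, E)) ∞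
    (fun p : TotalSpace F V => (⟨p.1, anchor p.1 p.2⟩ : TangentBundle I M))

/-- The vector field `a(X)` on `M` which is the image of the section `X` under the anchor. -/
def Anchor.field (a : Anchor I F V) (X : Cₛ^∞⟮I; F, V⟯) : Cₛ^∞⟮I; E, (TangentSpace I : M → Type _)⟯ :=
  ⟨fun x => a.anchor x (X x), a.anchor_smooth.comp X.contMDiff⟩

/-- The function `a(X)(f)`, the derivative of the function `f` along the vector field `a(X)`. -/
def Anchor.act (a : Anchor I F V) (X : Cₛ^∞⟮I; F, V⟯) (f : C^∞⟮I, M; ℝ⟯) : C^∞⟮I, M; ℝ⟯ :=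
  ⟨fun x => dirDeriv I f x (a.field X x), contMDiff_dirDeriv f.contMDiff (a.field X).contMDiff⟩

variable (I F V) in
/-- A Lie algebroid structure on the vector bundle `V`. -/
structure LieAlgebroid extends Anchor I F V where
  /-- The bracket of sections. -/
  bracket : Cₛ^∞⟮I; F, V⟯ →ₗ[ℝ] Cₛ^∞⟮I; F, V⟯ →ₗ[ℝ] Cₛ^∞⟮I; F, V⟯
  bracket_self : ∀ X, bracket X X = 0
  jacobi : ∀ X Y Z, bracket X (bracket Y Z) = bracket (bracket X Y) Z + bracket Y (bracket X Z)
  leibniz : ∀ X (f : C^∞⟮I, M; ℝ⟯) Y,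
    bracket X (f • Y) = f • bracket X Y + toAnchor.act X f • Y
  anchor_bracket : ∀ X Y x, toAnchor.field (bracket X Y) x =
    VectorField.mlieBracket I (toAnchor.field X) (toAnchor.field Y) x

variable (F' W) in
/-- A representation of the Lie algebroid `L` on the vector bundle `W`: a morphism of Lie algebroids
over `M` from `L` to the Lie algebroid `CDO(W)` of covariant differential operators on `W`,
given by its effect on sections. -/
structure LieAlgebroid.Representation (L : LieAlgebroid I F V) where
  /-- The operator `ρ_X` on the sections of `W`. -/
  toFun : Cₛ^∞⟮I; F, V⟯ →ₗ[ℝ] Cₛ^∞⟮I; F', W⟯ →ₗ[ℝ] Cₛ^∞⟮I; F', W⟯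
  smul_left : ∀ (f : C^∞⟮I, M; ℝ⟯) X s, toFun (f • X) s = f • toFun X s
  leibniz : ∀ X (f : C^∞⟮I, M; ℝ⟯) s, toFun X (f • s) = f • toFun X s + L.act X f • s
  map_bracket : ∀ X Y s,
    toFun (L.bracket X Y) s = toFun X (toFun Y s) - toFun Y (toFun X s)

/-- Two Lie algebroids over the same base, with representations of each on the vector bundle
underlying the other, form a matched pair. -/
structure IsMatchedPair (A : LieAlgebroid I F V) (B : LieAlgebroid I F' W)
    (ρ : A.Representation F' W) (σ : B.Representation F V) : Prop where
  left : ∀ X Y₁ Y₂, ρ.toFun X (B.bracket Y₁ Y₂) =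
    B.bracket (ρ.toFun X Y₁) Y₂ + B.bracket Y₁ (ρ.toFun X Y₂)
      + ρ.toFun (σ.toFun Y₂ X) Y₁ - ρ.toFun (σ.toFun Y₁ X) Y₂
  right : ∀ Y X₁ X₂, σ.toFun Y (A.bracket X₁ X₂) =
    A.bracket (σ.toFun Y X₁) X₂ + A.bracket X₁ (σ.toFun Y X₂)
      + σ.toFun (ρ.toFun X₂ Y) X₁ - σ.toFun (ρ.toFun X₁ Y) X₂
  anchors : ∀ X Y x, A.field (σ.toFun Y X) x - B.field (ρ.toFun X Y) x =
    VectorField.mlieBracket I (B.field Y) (A.field X) x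

theorem Anchor.act_apply (a : Anchor I F V) (X : Cₛ^∞⟮I; F, V⟯) (f : C^∞⟮I, M; ℝ⟯) (x : M) :
    a.act X f x = dirDeriv I f x (a.anchor x (X x)) := rfl

theorem Anchor.act_add_left (a : Anchor I F V) (X Y : Cₛ^∞⟮I; F, V⟯) (f : C^∞⟮I, M; ℝ⟯) :
    a.act (X + Y) f = a.act X f + a.act Y f := by
  ext x
  show dirDeriv I f x (a.anchor x (X x + Y x)) = _
  rw [map_add, dirDeriv_add_right]
  rfl

theorem Anchor.act_smul_left (a : Anchor I F V) (g : C^∞⟮I, M; ℝ⟯) (X : Cₛ^∞⟮I; F, V⟯)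
    (f : C^∞⟮I, M; ℝ⟯) : a.act (g • X) f = g * a.act X f := by
  ext x
  show dirDeriv I f x (a.anchor x (g x • X x)) = _
  rw [map_smul, dirDeriv_smul_right]
  rfl

theorem Anchor.act_const_smul_left (a : Anchor I F V) (c : ℝ) (X : Cₛ^∞⟮I; F, V⟯)
    (f : C^∞⟮I, M; ℝ⟯) : a.act (c • X) f = c • a.act X f := by
  ext x
  show dirDeriv I f x (a.anchor x (c • X x)) = _
  rw [map_smul, dirDeriv_smul_right]
  rfl

theorem Anchor.act_add_right (a : Anchor I F V) (X : Cₛ^∞⟮I; F, V⟯) (f g : C^∞⟮I, M; ℝ⟯) :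
    a.act X (f + g) = a.act X f + a.act X g := by
  ext x
  exact dirDeriv_add_left (f.contMDiff.mdifferentiable (by simp) x)
    (g.contMDiff.mdifferentiable (by simp) x) _

theorem Anchor.act_mul_right (a : Anchor I F V) (X : Cₛ^∞⟮I; F, V⟯) (f g : C^∞⟮I, M; ℝ⟯) :
    a.act X (f * g) = f * a.act X g + a.act X f * g := by
  ext x
  exact dirDeriv_mul_left (f.contMDiff.mdifferentiable (by simp) x)
    (g.contMDiff.mdifferentiable (by simp) x) _

theorem Anchor.act_const_smul_right (a : Anchor I F V) (X : Cₛ^∞⟮I; F, V⟯) (c : ℝ)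
    (f : C^∞⟮I, M; ℝ⟯) : a.act X (c • f) = c • a.act X f := by
  ext x
  have h := dirDeriv_mul_left (I := I) (f := fun _ : M => c) (x := x) mdifferentiableAt_const
    (f.contMDiff.mdifferentiable (by simp) x) (a.field X x)
  have h0 : dirDeriv I (fun _ : M => c) x (a.field X x) = 0 := by
    rw [dirDeriv, mfderiv_const]
    rfl
  rw [h0, zero_mul, add_zero] at h
  exact h

theorem Anchor.act_neg_right (a : Anchor I F V) (X : Cₛ^∞⟮I; F, V⟯) (f : C^∞⟮I, M; ℝ⟯) :
    a.act X (-f) = -a.act X f := by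
  rw [← neg_one_smul ℝ f, act_const_smul_right, neg_one_smul]

theorem Anchor.act_sub_right (a : Anchor I F V) (X : Cₛ^∞⟮I; F, V⟯) (f g : C^∞⟮I, M; ℝ⟯) :
    a.act X (f - g) = a.act X f - a.act X g := by
  rw [sub_eq_add_neg, act_add_right, act_neg_right, ← sub_eq_add_neg]

theorem LieAlgebroid.act_bracket [CompleteSpace E] (L : LieAlgebroid I F V)
    (X Y : Cₛ^∞⟮I; F, V⟯) (f : C^∞⟮I, M; ℝ⟯) :
    L.act (L.bracket X Y) f = L.act X (L.act Y f) - L.act Y (L.act X f) := by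
  ext x
  show dirDeriv I f x (L.field (L.bracket X Y) x) = _
  rw [L.anchor_bracket, dirDeriv_mlieBracket f.contMDiff (L.field X).contMDiff
    (L.field Y).contMDiff]
  rfl

end Definitions

section Sums

variable {E : Type*} [NormedAddCommGroup E] [NormedSpace ℝ E]
  {H : Type*} [TopologicalSpace H] {I : ModelWithCorners ℝ E H}
  {M : Type*} [TopologicalSpace M] [ChartedSpace H M]
  {F : Type*} [NormedAddCommGroup F] [NormedSpace ℝ F]
  {V : M → Type*} [TopologicalSpace (TotalSpace F V)] [∀ x, AddCommGroup (V x)]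
  [∀ x, Module ℝ (V x)] [∀ x, TopologicalSpace (V x)] [FiberBundle F V] [VectorBundle ℝ F V]
  {F' : Type*} [NormedAddCommGroup F'] [NormedSpace ℝ F']
  {W : M → Type*} [TopologicalSpace (TotalSpace F' W)] [∀ x, AddCommGroup (W x)]
  [∀ x, Module ℝ (W x)] [∀ x, TopologicalSpace (W x)] [FiberBundle F' W] [VectorBundle ℝ F' W]

theorem contMDiff_sum_fst : ContMDiff (I.prod 𝓘(ℝ, F × F')) (I.prod 𝓘(ℝ, F)) ∞
    (fun p : TotalSpace (F × F') (V ×ᵇ W) => (⟨p.1, p.2.1⟩ : TotalSpace F V)) := by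
  intro p₀
  have h := (contMDiffAt_totalSpace (n := ∞)).1
    (contMDiffAt_id (I := I.prod 𝓘(ℝ, F × F')) (x := p₀))
  rw [contMDiffAt_totalSpace]
  exact ⟨h.1, ((ContinuousLinearMap.fst ℝ F F').contMDiff.contMDiffAt.comp p₀ h.2 :)⟩

theorem contMDiff_sum_snd : ContMDiff (I.prod 𝓘(ℝ, F × F')) (I.prod 𝓘(ℝ, F')) ∞
    (fun p : TotalSpace (F × F') (V ×ᵇ W) => (⟨p.1, p.2.2⟩ : TotalSpace F' W)) := by
  intro p₀
  have h := (contMDiffAt_totalSpace (n := ∞)).1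
    (contMDiffAt_id (I := I.prod 𝓘(ℝ, F × F')) (x := p₀))
  rw [contMDiffAt_totalSpace]
  exact ⟨h.1, ((ContinuousLinearMap.snd ℝ F F').contMDiff.contMDiffAt.comp p₀ h.2 :)⟩

/-- The first component of a section of the direct sum `V ⊕ W`. -/
def fstSection (s : Cₛ^∞⟮I; F × F', V ×ᵇ W⟯) : Cₛ^∞⟮I; F, V⟯ :=
  ⟨fun x => (s x).1, contMDiff_sum_fst.comp s.contMDiff⟩

/-- The second component of a section of the direct sum `V ⊕ W`. -/
def sndSection (s : Cₛ^∞⟮I; F × F', V ×ᵇ W⟯) : Cₛ^∞⟮I; F', W⟯ :=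
  ⟨fun x => (s x).2, contMDiff_sum_snd.comp s.contMDiff⟩

/-- The section `s ⊕ t` of the direct sum `V ⊕ W`. -/
def mkSection (s : Cₛ^∞⟮I; F, V⟯) (t : Cₛ^∞⟮I; F', W⟯) : Cₛ^∞⟮I; F × F', V ×ᵇ W⟯ :=
  ⟨fun x => (s x, t x), fun x₀ => by
    have h1 := (contMDiffAt_section (IB := I) (n := ∞) x₀).1 (s.contMDiff x₀)
    have h2 := (contMDiffAt_section (IB := I) (n := ∞) x₀).1 (t.contMDiff x₀)
    exact (contMDiffAt_section (F := F × F') (E := V ×ᵇ W) x₀).2 (h1.prodMk_space h2)⟩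

@[simp]
theorem fstSection_mk (s : Cₛ^∞⟮I; F, V⟯) (t : Cₛ^∞⟮I; F', W⟯) :
    fstSection (mkSection s t) = s := rfl

@[simp]
theorem sndSection_mk (s : Cₛ^∞⟮I; F, V⟯) (t : Cₛ^∞⟮I; F', W⟯) :
    sndSection (mkSection s t) = t := rfl

theorem sum_section_ext {s t : Cₛ^∞⟮I; F × F', V ×ᵇ W⟯} (h1 : fstSection s = fstSection t)
    (h2 : sndSection s = sndSection t) : s = t := by
  refine ContMDiffSection.ext fun x => Prod.ext ?_ ?_
  · exact congrArg (fun u : Cₛ^∞⟮I; F, V⟯ => u x) h1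
  · exact congrArg (fun u : Cₛ^∞⟮I; F', W⟯ => u x) h2

theorem fstSection_add (s t : Cₛ^∞⟮I; F × F', V ×ᵇ W⟯) :
    fstSection (s + t) = fstSection s + fstSection t := rfl

theorem sndSection_add (s t : Cₛ^∞⟮I; F × F', V ×ᵇ W⟯) :
    sndSection (s + t) = sndSection s + sndSection t := rfl

theorem fstSection_const_smul (c : ℝ) (s : Cₛ^∞⟮I; F × F', V ×ᵇ W⟯) :
    fstSection (c • s) = c • fstSection s := rfl

theorem sndSection_const_smul (c : ℝ) (s : Cₛ^∞⟮I; F × F', V ×ᵇ W⟯) :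
    sndSection (c • s) = c • sndSection s := rfl

theorem fstSection_smul (f : C^∞⟮I, M; ℝ⟯) (s : Cₛ^∞⟮I; F × F', V ×ᵇ W⟯) :
    fstSection (f • s) = f • fstSection s := rfl

theorem sndSection_smul (f : C^∞⟮I, M; ℝ⟯) (s : Cₛ^∞⟮I; F × F', V ×ᵇ W⟯) :
    sndSection (f • s) = f • sndSection s := rfl

theorem contMDiff_neg_totalSpace : ContMDiff (I.prod 𝓘(ℝ, F)) (I.prod 𝓘(ℝ, F)) ∞
    (fun p : TotalSpace F V => (⟨p.1, -p.2⟩ : TotalSpace F V)) := by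
  intro p₀
  have h := (contMDiffAt_totalSpace (n := ∞)).1
    (contMDiffAt_id (I := I.prod 𝓘(ℝ, F)) (x := p₀))
  rw [contMDiffAt_totalSpace]
  refine ⟨h.1, h.2.neg.congr_of_eventuallyEq ?_⟩
  have hU : ∀ᶠ p : TotalSpace F V in 𝓝 p₀, p.1 ∈ (trivializationAt F V p₀.1).baseSet :=
    (FiberBundle.continuous_proj F V).continuousAt.eventually
      ((trivializationAt F V p₀.1).open_baseSet.mem_nhds
        (FiberBundle.mem_baseSet_trivializationAt F V p₀.1))
  filter_upwards [hU] with p hp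
  have := ((trivializationAt F V p₀.1).linear ℝ hp).map_smul (-1) p.2
  simpa using this

end Sums

section Duals

variable {E : Type*} [NormedAddCommGroup E] [NormedSpace ℝ E]
  {H : Type*} [TopologicalSpace H] {I : ModelWithCorners ℝ E H}
  {M : Type*} [TopologicalSpace M] [ChartedSpace H M]
  {F : Type*} [NormedAddCommGroup F] [NormedSpace ℝ F]
  {V : M → Type*} [TopologicalSpace (TotalSpace F V)] [∀ x, AddCommGroup (V x)]
  [∀ x, Module ℝ (V x)] [∀ x, TopologicalSpace (V x)] [FiberBundle F V] [VectorBundle ℝ F V]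
  {F' : Type*} [NormedAddCommGroup F'] [NormedSpace ℝ F']
  {W : M → Type*} [TopologicalSpace (TotalSpace F' W)] [∀ x, AddCommGroup (W x)]
  [∀ x, Module ℝ (W x)] [∀ x, TopologicalSpace (W x)] [FiberBundle F' W] [VectorBundle ℝ F' W]
  [IsManifold I ∞ M]

section Algebroids

theorem smul_add_smul_sub_smul (f g : C^∞⟮I, M; ℝ⟯) (s t u : Cₛ^∞⟮I; F, V⟯) :
    f • s + g • u - f • t = f • (s - t) + g • u := by
  refine ContMDiffSection.ext fun x => ?_
  show f x • s x + g x • u x - f x • t x = f x • (s x - t x) + g x • u x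
  rw [smul_sub]
  exact add_sub_right_comm _ _ _

/-- The opposite of a Lie algebroid: the bracket and the anchor change sign. -/
def LieAlgebroid.opposite [FiniteDimensional ℝ E] (L : LieAlgebroid I F V) : LieAlgebroid I F V where
  anchor x := -L.anchor x
  anchor_smooth := contMDiff_neg_totalSpace.comp L.anchor_smooth
  bracket := -L.bracket
  bracket_self X := by
    show -L.bracket X X = 0
    rw [L.bracket_self, neg_zero]
  jacobi X Y Z := by
    show -L.bracket X (-L.bracket Y Z) = -L.bracket (-L.bracket X Y) Z + -L.bracket Y (-L.bracket X Z)
    simp only [map_neg, LinearMap.neg_apply, neg_neg]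
    exact L.jacobi X Y Z
  leibniz X f Y := by
    refine ContMDiffSection.ext fun x => ?_
    have h := congrArg (fun s : Cₛ^∞⟮I; F, V⟯ => s x) (L.leibniz X f Y)
    show -(L.bracket X (f • Y) x) =
      f x • -(L.bracket X Y x) + dirDeriv I f x (-L.anchor x (X x)) • Y x
    have h' : L.bracket X (f • Y) x =
      f x • L.bracket X Y x + dirDeriv I f x (L.anchor x (X x)) • Y x := h
    rw [h', dirDeriv_neg_right, smul_neg, neg_smul, neg_add]
  anchor_bracket X Y x := by
    have : CompleteSpace E := FiniteDimensional.complete ℝ E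
    have h := L.anchor_bracket X Y x
    have h1 : L.anchor x (-(L.bracket X Y x)) = -L.field (L.bracket X Y) x := map_neg _ _
    have h2 : ∀ Z : Cₛ^∞⟮I; F, V⟯, (fun y => -L.anchor y (Z y)) =
      (((-1 : ℝ) • (fun y => L.field Z y) : (y : M) → TangentSpace I y)) := fun Z => by
        funext y
        exact (neg_one_smul ℝ _).symm
    have hd : ∀ Z : Cₛ^∞⟮I; F, V⟯, MDifferentiableAt I (I.prod 𝓘(ℝ, E))
        (fun y => TotalSpace.mk' E y (L.field Z y)) x :=
      fun Z => (L.field Z).contMDiff.mdifferentiable (by simp) x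
    show -L.anchor x (-(L.bracket X Y x)) =
      VectorField.mlieBracket I (fun y => -L.anchor y (X y)) (fun y => -L.anchor y (Y y)) x
    rw [h1, neg_neg, h2, h2, VectorField.mlieBracket_const_smul_left (hd X),
      VectorField.mlieBracket_const_smul_right (hd Y), smul_smul, h]
    simp

/-- The semidirect product `V ⋉ W` of a Lie algebroid `V` with a vector bundle `W` on which it is
represented; the underlying vector bundle is `V ⊕ W`. -/
def LieAlgebroid.semidirect (L : LieAlgebroid I F V) (R : L.Representation F' W) :
    LieAlgebroid I (F × F') (V ×ᵇ W) where
  anchor x := (L.anchor x).comp (LinearMap.fst ℝ (V x) (W x))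
  anchor_smooth := L.anchor_smooth.comp contMDiff_sum_fst
  bracket := LinearMap.mk₂ ℝ
    (fun s₁ s₂ => mkSection (L.bracket (fstSection s₁) (fstSection s₂))
      (R.toFun (fstSection s₁) (sndSection s₂) - R.toFun (fstSection s₂) (sndSection s₁)))
    (fun s₁ s₂ t => by
      apply sum_section_ext <;>
        simp only [fstSection_mk, sndSection_mk, fstSection_add, sndSection_add, map_add,
          LinearMap.add_apply]
      abel)
    (fun c s t => by
      apply sum_section_ext <;>
        simp only [fstSection_mk, sndSection_mk, fstSection_const_smul, sndSection_const_smul,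
          map_smul, LinearMap.smul_apply, smul_sub])
    (fun s t₁ t₂ => by
      apply sum_section_ext <;>
        simp only [fstSection_mk, sndSection_mk, fstSection_add, sndSection_add, map_add,
          LinearMap.add_apply]
      abel)
    (fun c s t => by
      apply sum_section_ext <;>
        simp only [fstSection_mk, sndSection_mk, fstSection_const_smul, sndSection_const_smul,
          map_smul, LinearMap.smul_apply, smul_sub])
  bracket_self s := by
    apply sum_section_ext
    · exact L.bracket_self _
    · exact sub_self _
  jacobi s t u := by
    apply sum_section_ext
    · exact L.jacobi _ _ _
    · simp only [LinearMap.mk₂_apply, fstSection_mk, sndSection_mk, sndSection_add, map_sub,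
        R.map_bracket]
      abel
  leibniz s f t := by
    apply sum_section_ext
    · exact L.leibniz (fstSection s) f (fstSection t)
    · simp only [LinearMap.mk₂_apply, sndSection_mk, sndSection_add, fstSection_smul,
        sndSection_smul, R.leibniz, R.smul_left]
      exact smul_add_smul_sub_smul _ _ _ _ _
  anchor_bracket s t x := L.anchor_bracket (fstSection s) (fstSection t) x

/-- The semidirect product `W ⋊ V` of a Lie algebroid `V` with a vector bundle `W` on which it is
represented, with the factors in the other order: the underlying vector bundle is `W ⊕ V`. -/
def LieAlgebroid.semidirectRight (L : LieAlgebroid I F V) (R : L.Representation F' W) :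
    LieAlgebroid I (F' × F) (W ×ᵇ V) where
  anchor x := (L.anchor x).comp (LinearMap.snd ℝ (W x) (V x))
  anchor_smooth := L.anchor_smooth.comp contMDiff_sum_snd
  bracket := LinearMap.mk₂ ℝ
    (fun s₁ s₂ => mkSection
      (R.toFun (sndSection s₁) (fstSection s₂) - R.toFun (sndSection s₂) (fstSection s₁))
      (L.bracket (sndSection s₁) (sndSection s₂)))
    (fun s₁ s₂ t => by
      apply sum_section_ext <;>
        simp only [fstSection_mk, sndSection_mk, fstSection_add, sndSection_add, map_add,
          LinearMap.add_apply]
      abel)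
    (fun c s t => by
      apply sum_section_ext <;>
        simp only [fstSection_mk, sndSection_mk, fstSection_const_smul, sndSection_const_smul,
          map_smul, LinearMap.smul_apply, smul_sub])
    (fun s t₁ t₂ => by
      apply sum_section_ext <;>
        simp only [fstSection_mk, sndSection_mk, fstSection_add, sndSection_add, map_add,
          LinearMap.add_apply]
      abel)
    (fun c s t => by
      apply sum_section_ext <;>
        simp only [fstSection_mk, sndSection_mk, fstSection_const_smul, sndSection_const_smul,
          map_smul, LinearMap.smul_apply, smul_sub])
  bracket_self s := by
    apply sum_section_ext
    · exact sub_self _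
    · exact L.bracket_self _
  jacobi s t u := by
    apply sum_section_ext
    · simp only [LinearMap.mk₂_apply, fstSection_mk, sndSection_mk, fstSection_add, map_sub,
        R.map_bracket]
      abel
    · exact L.jacobi _ _ _
  leibniz s f t := by
    apply sum_section_ext
    · simp only [LinearMap.mk₂_apply, fstSection_mk, fstSection_add, fstSection_smul,
        sndSection_smul, R.leibniz, R.smul_left]
      exact smul_add_smul_sub_smul _ _ _ _ _
    · exact L.leibniz (sndSection s) f (sndSection t)
  anchor_bracket s t x := L.anchor_bracket (sndSection s) (sndSection t) x

theorem LieAlgebroid.semidirect_bracket (L : LieAlgebroid I F V) (R : L.Representation F' W)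
    (X₁ X₂ : Cₛ^∞⟮I; F, V⟯) (s₁ s₂ : Cₛ^∞⟮I; F', W⟯) :
    (L.semidirect R).bracket (mkSection X₁ s₁) (mkSection X₂ s₂) =
      mkSection (L.bracket X₁ X₂) (R.toFun X₁ s₂ - R.toFun X₂ s₁) := rfl

theorem LieAlgebroid.opposite_semidirectRight_bracket [FiniteDimensional ℝ E]
    (L : LieAlgebroid I F V) (R : L.Representation F' W)
    (X₁ X₂ : Cₛ^∞⟮I; F, V⟯) (s₁ s₂ : Cₛ^∞⟮I; F', W⟯) :
    (L.semidirectRight R).opposite.bracket (mkSection s₁ X₁) (mkSection s₂ X₂) =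
      mkSection (R.toFun X₂ s₁ - R.toFun X₁ s₂) (L.bracket X₂ X₁) := by
  apply sum_section_ext
  · exact neg_sub (R.toFun X₁ s₂) (R.toFun X₂ s₁)
  · have h := L.bracket_self (X₁ + X₂)
    simp only [map_add, LinearMap.add_apply, L.bracket_self, zero_add, add_zero] at h
    exact neg_eq_of_add_eq_zero_left h

theorem LieAlgebroid.opposite_semidirectRight_anchor [FiniteDimensional ℝ E]
    (L : LieAlgebroid I F V) (R : L.Representation F' W) (x : M) (p : W x × V x) :
    (L.semidirectRight R).opposite.anchor x p = -L.anchor x p.2 := rfl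

end Algebroids

section DualPairing

/-- The bundle `W*` dual to `W` is in duality with `W` by evaluation. -/
def dualPairing [FiniteDimensional ℝ F'] :
    BundlePairing I (F' →L[ℝ] ℝ) (fun x => W x →L[ℝ] ℝ) F' W where
  toFun x := ContinuousLinearMap.coeLM ℝ
  smooth s t := by
    have h := ContMDiff.clm_bundle_apply (F₂ := ℝ) (E₂ := Bundle.Trivial M ℝ) (IM := I)
      (b := fun x => x) (ϕ := fun x => s x) s.contMDiff t.contMDiff
    intro x
    exact ((contMDiffAt_totalSpace).1 (h x)).2
  perfect x := by
    have hf : FiniteDimensional ℝ (W x) := VectorBundle.finiteDimensional ℝ F' W x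
    let e := VectorBundle.continuousLinearEquivAt ℝ F' W x
    refine LinearMap.IsPerfPair.of_bijective _ ⟨fun φ ψ h => ?_, fun φ => ?_⟩
    · exact ContinuousLinearMap.coe_injective h
    · refine ⟨(LinearMap.toContinuousLinearMap (φ.comp e.symm.toLinearMap)).comp
        (e : W x →L[ℝ] F'), ?_⟩
      ext w
      show φ (e.symm (e w)) = φ w
      rw [e.symm_apply_apply]

@[simp]
theorem dualPairing_pair_apply [FiniteDimensional ℝ F']
    (ψ : Cₛ^∞⟮I; F' →L[ℝ] ℝ, fun x => W x →L[ℝ] ℝ⟯) (Y : Cₛ^∞⟮I; F', W⟯) (x : M) :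
    dualPairing.pair ψ Y x = ψ x (Y x) := rfl

end DualPairing

section PairLemmas

namespace BundlePairing

variable (P : BundlePairing I F V F' W)

theorem pair_add_left (s s' : Cₛ^∞⟮I; F, V⟯) (t : Cₛ^∞⟮I; F', W⟯) :
    P.pair (s + s') t = P.pair s t + P.pair s' t := by
  ext x
  exact LinearMap.map_add₂ (P.toFun x) (s x) (s' x) (t x)

theorem pair_add_right (s : Cₛ^∞⟮I; F, V⟯) (t t' : Cₛ^∞⟮I; F', W⟯) :
    P.pair s (t + t') = P.pair s t + P.pair s t' := by
  ext x
  exact map_add (P.toFun x (s x)) (t x) (t' x)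

theorem pair_sub_right (s : Cₛ^∞⟮I; F, V⟯) (t t' : Cₛ^∞⟮I; F', W⟯) :
    P.pair s (t - t') = P.pair s t - P.pair s t' := by
  ext x
  exact map_sub (P.toFun x (s x)) (t x) (t' x)

theorem pair_sub_left (s s' : Cₛ^∞⟮I; F, V⟯) (t : Cₛ^∞⟮I; F', W⟯) :
    P.pair (s - s') t = P.pair s t - P.pair s' t := by
  ext x
  exact LinearMap.map_sub₂ (P.toFun x) (s x) (s' x) (t x)

theorem pair_neg_left (s : Cₛ^∞⟮I; F, V⟯) (t : Cₛ^∞⟮I; F', W⟯) :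
    P.pair (-s) t = -P.pair s t := by
  ext x
  exact LinearMap.map_neg₂ (P.toFun x) (s x) (t x)

theorem pair_smul_left (f : C^∞⟮I, M; ℝ⟯) (s : Cₛ^∞⟮I; F, V⟯) (t : Cₛ^∞⟮I; F', W⟯) :
    P.pair (f • s) t = f * P.pair s t := by
  ext x
  exact LinearMap.map_smul₂ (P.toFun x) (f x) (s x) (t x)

theorem pair_smul_right (f : C^∞⟮I, M; ℝ⟯) (s : Cₛ^∞⟮I; F, V⟯) (t : Cₛ^∞⟮I; F', W⟯) :
    P.pair s (f • t) = f * P.pair s t := by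
  ext x
  exact map_smul (P.toFun x (s x)) (f x) (t x)

theorem pair_const_smul_left (c : ℝ) (s : Cₛ^∞⟮I; F, V⟯) (t : Cₛ^∞⟮I; F', W⟯) :
    P.pair (c • s) t = c • P.pair s t := by
  ext x
  exact LinearMap.map_smul₂ (P.toFun x) c (s x) (t x)

theorem pair_const_smul_right (c : ℝ) (s : Cₛ^∞⟮I; F, V⟯) (t : Cₛ^∞⟮I; F', W⟯) :
    P.pair s (c • t) = c • P.pair s t := by
  ext x
  exact map_smul (P.toFun x (s x)) c (t x)

variable [FiniteDimensional ℝ E] [T2Space M]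
  [FiniteDimensional ℝ F] [ContMDiffVectorBundle ∞ F V I]
  [FiniteDimensional ℝ F'] [ContMDiffVectorBundle ∞ F' W I]

theorem section_ext {s s' : Cₛ^∞⟮I; F, V⟯} (h : ∀ t, P.pair s t = P.pair s' t) : s = s' := by
  obtain ⟨u, -, hu⟩ := P.existsUnique_section (Φ := P.pair s') (P.pair_add_right s')
    (fun f t => P.pair_smul_right f s' t)
  rw [hu s h, hu s' fun _ => rfl]

/-- A derivation `D` of the sections of `W` over a derivation `δ` of the functions has a
contragredient operator on the sections of the bundle `V` in duality with `W`. -/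
theorem existsUnique_contragredient {δ : C^∞⟮I, M; ℝ⟯ → C^∞⟮I, M; ℝ⟯}
    {D : Cₛ^∞⟮I; F', W⟯ → Cₛ^∞⟮I; F', W⟯}
    (hδadd : ∀ f g, δ (f + g) = δ f + δ g) (hδmul : ∀ f g, δ (f * g) = f * δ g + δ f * g)
    (hDadd : ∀ s t, D (s + t) = D s + D t)
    (hDsmul : ∀ (f : C^∞⟮I, M; ℝ⟯) t, D (f • t) = f • D t + δ f • t) (s : Cₛ^∞⟮I; F, V⟯) :
    ∃! s' : Cₛ^∞⟮I; F, V⟯, ∀ t, P.pair s' t = δ (P.pair s t) - P.pair s (D t) := by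
  refine P.existsUnique_section (fun t t' => ?_) (fun f t => ?_)
  · rw [pair_add_right, hδadd, hDadd, pair_add_right]
    ring
  · rw [pair_smul_right, hδmul, hDsmul, pair_add_right, pair_smul_right, pair_smul_right]
    ring

end BundlePairing

end PairLemmas

section Contragredient

variable [FiniteDimensional ℝ E] [T2Space M] [FiniteDimensional ℝ F'] [ContMDiffVectorBundle ∞ F' W I]

namespace LieAlgebroid.Representation

variable {L : LieAlgebroid I F V}

theorem existsUnique_contragredient (R : L.Representation F' W) (X : Cₛ^∞⟮I; F, V⟯)
    (ψ : Cₛ^∞⟮I; F' →L[ℝ] ℝ, fun x => W x →L[ℝ] ℝ⟯) :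
    ∃! ψ' : Cₛ^∞⟮I; F' →L[ℝ] ℝ, fun x => W x →L[ℝ] ℝ⟯, ∀ Y,
      dualPairing.pair ψ' Y = L.act X (dualPairing.pair ψ Y) - dualPairing.pair ψ (R.toFun X Y) :=
  dualPairing.existsUnique_contragredient (L.act_add_right X) (L.act_mul_right X)
    (fun s t => map_add (R.toFun X) s t) (R.leibniz X) ψ

/-- The contragredient operator `ρ^(*)_X` on the sections of `W*`. -/
def contragredientFun (R : L.Representation F' W) (X : Cₛ^∞⟮I; F, V⟯)
    (ψ : Cₛ^∞⟮I; F' →L[ℝ] ℝ, fun x => W x →L[ℝ] ℝ⟯) :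
    Cₛ^∞⟮I; F' →L[ℝ] ℝ, fun x => W x →L[ℝ] ℝ⟯ :=
  (R.existsUnique_contragredient X ψ).choose

/-- The defining property `⟨ρ^(*)_X ψ, Y⟩ = a(X)⟨ψ, Y⟩ - ⟨ψ, ρ_X Y⟩`. -/
theorem pair_contragredientFun (R : L.Representation F' W) (X : Cₛ^∞⟮I; F, V⟯)
    (ψ : Cₛ^∞⟮I; F' →L[ℝ] ℝ, fun x => W x →L[ℝ] ℝ⟯) (Y : Cₛ^∞⟮I; F', W⟯) :
    dualPairing.pair (R.contragredientFun X ψ) Y =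
      L.act X (dualPairing.pair ψ Y) - dualPairing.pair ψ (R.toFun X Y) :=
  (R.existsUnique_contragredient X ψ).choose_spec.1 Y

/-- The contragredient representation `ρ^(*)` of `L` on the dual bundle `W*`. -/
def contragredient (R : L.Representation F' W) :
    L.Representation (F' →L[ℝ] ℝ) (fun x => W x →L[ℝ] ℝ) where
  toFun := LinearMap.mk₂ ℝ R.contragredientFun
    (fun X X' ψ => dualPairing.section_ext fun Y => by
      simp only [BundlePairing.pair_add_left, pair_contragredientFun, Anchor.act_add_left, map_add,
        LinearMap.add_apply, BundlePairing.pair_add_right]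
      abel)
    (fun c X ψ => dualPairing.section_ext fun Y => by
      simp only [BundlePairing.pair_const_smul_left, pair_contragredientFun,
        Anchor.act_const_smul_left, map_smul, LinearMap.smul_apply,
        BundlePairing.pair_const_smul_right, smul_sub])
    (fun X ψ ψ' => dualPairing.section_ext fun Y => by
      simp only [BundlePairing.pair_add_left, pair_contragredientFun, Anchor.act_add_right]
      abel)
    (fun c X ψ => dualPairing.section_ext fun Y => by
      simp only [BundlePairing.pair_const_smul_left, pair_contragredientFun,
        Anchor.act_const_smul_right, smul_sub])
  smul_left f X ψ := dualPairing.section_ext fun Y => by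
    simp only [LinearMap.mk₂_apply, BundlePairing.pair_smul_left, pair_contragredientFun,
      Anchor.act_smul_left, R.smul_left, BundlePairing.pair_smul_right]
    ring
  leibniz X f ψ := dualPairing.section_ext fun Y => by
    simp only [LinearMap.mk₂_apply, BundlePairing.pair_smul_left, BundlePairing.pair_add_left,
      pair_contragredientFun, Anchor.act_mul_right]
    ring
  map_bracket X X' ψ := dualPairing.section_ext fun Y => by
    have : CompleteSpace E := FiniteDimensional.complete ℝ E
    simp only [LinearMap.mk₂_apply, BundlePairing.pair_sub_left, pair_contragredientFun,
      L.act_bracket, R.map_bracket, BundlePairing.pair_sub_right, Anchor.act_sub_right]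
    ring

end LieAlgebroid.Representation

end Contragredient

section Bialgebroids

variable (I F V) in
/-- A section of `Λ²V*`, given as a bilinear alternating form, over the ring of smooth functions, on
the module of sections of `V`. -/
@[ext]
structure TwoForm where
  /-- The value `κ(u, v)` of the form on two sections. -/
  toFun : Cₛ^∞⟮I; F, V⟯ → Cₛ^∞⟮I; F, V⟯ → C^∞⟮I, M; ℝ⟯
  add_left : ∀ u u' v, toFun (u + u') v = toFun u v + toFun u' v
  smul_left : ∀ (f : C^∞⟮I, M; ℝ⟯) u v, toFun (f • u) v = f * toFun u v
  swap : ∀ u v, toFun v u = -toFun u v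

theorem TwoForm.add_right (κ : TwoForm I F V) (u v v' : Cₛ^∞⟮I; F, V⟯) :
    κ.toFun u (v + v') = κ.toFun u v + κ.toFun u v' := by
  rw [κ.swap (v + v'), κ.swap v, κ.swap v', κ.add_left, neg_add]

theorem TwoForm.smul_right (κ : TwoForm I F V) (f : C^∞⟮I, M; ℝ⟯) (u v : Cₛ^∞⟮I; F, V⟯) :
    κ.toFun u (f • v) = f * κ.toFun u v := by
  rw [κ.swap (f • v), κ.swap v, κ.smul_left, mul_neg]

instance : Add (TwoForm I F V) :=
  ⟨fun κ θ =>
    { toFun := fun u v => κ.toFun u v + θ.toFun u v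
      add_left := fun u u' v => by rw [κ.add_left, θ.add_left]; ring
      smul_left := fun f u v => by rw [κ.smul_left, θ.smul_left]; ring
      swap := fun u v => by rw [κ.swap u v, θ.swap u v]; ring }⟩

instance : Neg (TwoForm I F V) :=
  ⟨fun κ =>
    { toFun := fun u v => -κ.toFun u v
      add_left := fun u u' v => by rw [κ.add_left]; ring
      smul_left := fun f u v => by rw [κ.smul_left]; ring
      swap := fun u v => by rw [κ.swap u v] }⟩

/-- The antisymmetry of the bracket. -/
theorem LieAlgebroid.bracket_swap (L : LieAlgebroid I F V) (X Y : Cₛ^∞⟮I; F, V⟯) :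
    L.bracket Y X = -L.bracket X Y := by
  have h := L.bracket_self (X + Y)
  simp only [map_add, LinearMap.add_apply, L.bracket_self, zero_add, add_zero] at h
  exact eq_neg_of_add_eq_zero_left h

/-- The differential `d^V ξ` of a `1`-form `ξ` on the Lie algebroid `V`, where the sections of a
bundle `W` in duality with `V` are regarded as the `1`-forms on `V`. -/
def LieAlgebroid.d (L : LieAlgebroid I F V) (P : BundlePairing I F V F' W)
    (ξ : Cₛ^∞⟮I; F', W⟯) : TwoForm I F V where
  toFun u v := L.act u (P.pair v ξ) - L.act v (P.pair u ξ) - P.pair (L.bracket u v) ξ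
  add_left u u' v := by
    simp only [map_add, LinearMap.add_apply, Anchor.act_add_left, Anchor.act_add_right,
      BundlePairing.pair_add_left]
    ring
  smul_left f u v := by
    rw [L.bracket_swap v (f • u), L.leibniz, L.bracket_swap u v, Anchor.act_smul_left,
      BundlePairing.pair_smul_left, Anchor.act_mul_right, BundlePairing.pair_neg_left,
      BundlePairing.pair_add_left, BundlePairing.pair_smul_left, BundlePairing.pair_smul_left,
      BundlePairing.pair_neg_left]
    ring
  swap u v := by
    rw [L.bracket_swap u v, BundlePairing.pair_neg_left]
    ring

variable [FiniteDimensional ℝ E] [T2Space M]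
  [FiniteDimensional ℝ F] [ContMDiffVectorBundle ∞ F V I]
  [FiniteDimensional ℝ F'] [ContMDiffVectorBundle ∞ F' W I]

theorem LieAlgebroid.existsUnique_lieDeriv (L' : LieAlgebroid I F' W)
    (P : BundlePairing I F V F' W) (ξ : Cₛ^∞⟮I; F', W⟯) (u : Cₛ^∞⟮I; F, V⟯) :
    ∃! u' : Cₛ^∞⟮I; F, V⟯, ∀ η,
      P.pair u' η = L'.act ξ (P.pair u η) - P.pair u (L'.bracket ξ η) :=
  P.existsUnique_contragredient (L'.act_add_right ξ) (L'.act_mul_right ξ)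
    (fun s t => map_add (L'.bracket ξ) s t) (L'.leibniz ξ) u

/-- The Lie derivative `L_ξ u` of a section `u` of `V`, regarded as a `1`-form on the Lie algebroid
`W` in duality with `V`, along a section `ξ` of `W`. -/
def LieAlgebroid.lieDeriv (L' : LieAlgebroid I F' W) (P : BundlePairing I F V F' W)
    (ξ : Cₛ^∞⟮I; F', W⟯) (u : Cₛ^∞⟮I; F, V⟯) : Cₛ^∞⟮I; F, V⟯ :=
  (L'.existsUnique_lieDeriv P ξ u).choose

/-- The defining property `⟨L_ξ u, η⟩ = ξ⟨u, η⟩ - ⟨u, [ξ, η]⟩`. -/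
theorem LieAlgebroid.pair_lieDeriv (L' : LieAlgebroid I F' W) (P : BundlePairing I F V F' W)
    (ξ η : Cₛ^∞⟮I; F', W⟯) (u : Cₛ^∞⟮I; F, V⟯) :
    P.pair (L'.lieDeriv P ξ u) η = L'.act ξ (P.pair u η) - P.pair u (L'.bracket ξ η) :=
  (L'.existsUnique_lieDeriv P ξ u).choose_spec.1 η

theorem LieAlgebroid.lieDeriv_add (L' : LieAlgebroid I F' W) (P : BundlePairing I F V F' W)
    (ξ : Cₛ^∞⟮I; F', W⟯) (u u' : Cₛ^∞⟮I; F, V⟯) :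
    L'.lieDeriv P ξ (u + u') = L'.lieDeriv P ξ u + L'.lieDeriv P ξ u' :=
  P.section_ext fun η => by
    simp only [BundlePairing.pair_add_left, pair_lieDeriv, Anchor.act_add_right]
    ring

theorem LieAlgebroid.lieDeriv_smul (L' : LieAlgebroid I F' W) (P : BundlePairing I F V F' W)
    (ξ : Cₛ^∞⟮I; F', W⟯) (f : C^∞⟮I, M; ℝ⟯) (u : Cₛ^∞⟮I; F, V⟯) :
    L'.lieDeriv P ξ (f • u) = f • L'.lieDeriv P ξ u + L'.act ξ f • u :=
  P.section_ext fun η => by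
    simp only [BundlePairing.pair_add_left, BundlePairing.pair_smul_left, pair_lieDeriv,
      Anchor.act_mul_right]
    ring

/-- The Schouten bracket `[ξ, κ]` of a section `ξ` of the Lie algebroid `W` with a section `κ` of
`Λ²W`, which is regarded as a `2`-form on the bundle `V` in duality with `W`. It is the Lie
derivative of `κ` along `ξ`, that is, the extension of the bracket `[ξ, -]` to a derivation. -/
def LieAlgebroid.schouten (L' : LieAlgebroid I F' W) (P : BundlePairing I F V F' W)
    (ξ : Cₛ^∞⟮I; F', W⟯) (κ : TwoForm I F V) : TwoForm I F V where
  toFun u v := L'.act ξ (κ.toFun u v) - κ.toFun (L'.lieDeriv P ξ u) v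
    - κ.toFun u (L'.lieDeriv P ξ v)
  add_left u u' v := by
    simp only [L'.lieDeriv_add, κ.add_left, Anchor.act_add_right]
    ring
  smul_left f u v := by
    simp only [L'.lieDeriv_smul, κ.add_left, κ.smul_left, Anchor.act_mul_right]
    ring
  swap u v := by
    rw [κ.swap u v, κ.swap u (L'.lieDeriv P ξ v), κ.swap (L'.lieDeriv P ξ u) v, Anchor.act_neg_right]
    ring

/-- Two Lie algebroids `V` and `W` in duality form a Lie bialgebroid: the differential of the
Lie algebroid `V` is a derivation of the bracket of `W`, that is,
`d[ξ, η] = [dξ, η] + [ξ, dη]`, where the Schouten bracket `[κ, η]` of a section `κ` of `Λ²W` with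
a section `η` of `W` is `-[η, κ]`. -/
def IsLieBialgebroid (L : LieAlgebroid I F V) (L' : LieAlgebroid I F' W)
    (P : BundlePairing I F V F' W) : Prop :=
  ∀ ξ η : Cₛ^∞⟮I; F', W⟯,
    L.d P (L'.bracket ξ η) = -L'.schouten P η (L.d P ξ) + L'.schouten P ξ (L.d P η)

end Bialgebroids

section SdpPairing

/-- The pairing `⟨X + ψ, φ + Y⟩ = ⟨φ, X⟩ - ⟨ψ, Y⟩` of the bundles `V ⊕ W*` and `V* ⊕ W`. -/
def sdpPairing [FiniteDimensional ℝ F] [FiniteDimensional ℝ F'] :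
    BundlePairing I (F × (F' →L[ℝ] ℝ)) (V ×ᵇ (fun x => W x →L[ℝ] ℝ))
      ((F →L[ℝ] ℝ) × F') ((fun x => V x →L[ℝ] ℝ) ×ᵇ W) where
  toFun x := LinearMap.mk₂ ℝ (fun p q => q.1 p.1 - p.2 q.2)
    (fun p p' q => by
      show q.1 (p.1 + p'.1) - (p.2 q.2 + p'.2 q.2) = _
      rw [map_add]
      abel)
    (fun c p q => by
      show q.1 (c • p.1) - c • (p.2 q.2) = _
      rw [map_smul, smul_sub])
    (fun p q q' => by
      show q.1 p.1 + q'.1 p.1 - p.2 (q.2 + q'.2) = _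
      rw [map_add]
      abel)
    (fun c p q => by
      show c • (q.1 p.1) - p.2 (c • q.2) = _
      rw [map_smul, smul_sub])
  smooth s t := ((dualPairing (I := I)).smooth (fstSection t) (fstSection s)).sub
    ((dualPairing (I := I)).smooth (sndSection s) (sndSection t))
  perfect x := by
    have hV : FiniteDimensional ℝ (V x × (W x →L[ℝ] ℝ)) :=
      VectorBundle.finiteDimensional ℝ (F × (F' →L[ℝ] ℝ)) (V ×ᵇ (fun x => W x →L[ℝ] ℝ)) x
    have hA := (dualPairing (I := I) (F' := F) (W := V)).perfect x
    have hB := (dualPairing (I := I) (F' := F') (W := W)).perfect x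
    refine LinearMap.IsPerfPair.of_injective ?_ ?_
    · refine LinearMap.ker_eq_bot.1 (LinearMap.ker_eq_bot'.2 fun p hp => Prod.ext ?_ ?_)
      · refine hA.bijective_right.1 (LinearMap.ext fun φ => ?_)
        have h : φ p.1 - p.2 0 = 0 := LinearMap.congr_fun hp (φ, 0)
        show φ p.1 = φ 0
        rwa [map_zero, sub_zero, ← map_zero φ] at h
      · refine hB.bijective_left.1 (LinearMap.ext fun y => ?_)
        have h : 0 - p.2 y = 0 := LinearMap.congr_fun hp (0, y)
        show p.2 y = 0
        linarith
    · refine LinearMap.ker_eq_bot.1 (LinearMap.ker_eq_bot'.2 fun q hq => Prod.ext ?_ ?_)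
      · refine hA.bijective_left.1 (LinearMap.ext fun y => ?_)
        have h : q.1 y - 0 = 0 := LinearMap.congr_fun hq (y, 0)
        show q.1 y = 0
        linarith
      · refine hB.bijective_right.1 (LinearMap.ext fun ψ => ?_)
        have h : q.1 0 - ψ q.2 = 0 := LinearMap.congr_fun hq (0, ψ)
        show ψ q.2 = ψ 0
        rw [map_zero] at h ⊢
        linarith

end SdpPairing

end Duals

end LieAlgebroids

end

/-!
The proof measures how far each side is from holding and compares the two failures.

Write sections of `A ⋉ B*` as `X ⊕ ψ` and sections of its dual as `φ ⊕ Y`. In components, the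
differential of `A ⋉ B*` is that of `A` on `φ`, and on `Y` it is the form pairing `X` with `ψ` to
`-⟨ψ, ρ_X Y⟩` (`d_semidirect`). The Lie derivative along `φ ⊕ Y` sends `X ⊕ ψ` to the section with
components `-σ_Y X` and `⟨σ^(*)_- φ, X⟩ - L_Y ψ` (`fstSection_lieDeriv`,
`pair_sndSection_lieDeriv`). Substituting these shows (`bialgebroid_defect`) that the failure of the
bialgebroid condition has exactly two kinds of components:

* for `Y₁, Y₂ ∈ ΓB`, the value on `X, ψ` is `⟨ψ, -⟩` applied to the failure of the matched pair
  condition on `ρ` (`derivDefect`);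
* for `φ ∈ ΓA*` and `Y ∈ ΓB`, the value on `X₁, X₂` is
  `⟨φ, R⟩ + θ(X₁, Y)⟨φ, X₂⟩ - θ(X₂, Y)⟨φ, X₁⟩` (`mixedDefect`), where `R` is the failure of the
  condition on `σ`, and `θ(X, Y) = a(σ_Y X) - b(ρ_X Y) - [b(Y), a(X)]` (`anchorDefect`).

All of them vanish for a matched pair. In the other direction, the second component alone does not
force `θ = 0` when `A` has rank one. The first one does: the condition on `ρ` is not linear over
functions in `Y₁`, and its deviation from linearity is `θ(X, Y₂)(f) Y₁` (`derivDefect_smul`). Hence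
the condition on `ρ` makes `θ` vanish (`anchorDefect_eq_zero`), and then the second component
reduces to `⟨φ, R⟩`.
-/

noncomputable section

namespace LieAlgebroids

/-! ### Functions separate tangent vectors -/

section TangentVectors

variable {E : Type*} [NormedAddCommGroup E] [NormedSpace ℝ E] [FiniteDimensional ℝ E]
  {H : Type*} [TopologicalSpace H] {I : ModelWithCorners ℝ E H}
  {M : Type*} [TopologicalSpace M] [ChartedSpace H M] [IsManifold I ∞ M] [T2Space M]

/-- Global smooth functions separate tangent vectors: the coordinate functions of a chart, cut off
by a bump function, already do so. -/
theorem eq_zero_of_dirDeriv_eq_zero {x : M} {v : TangentSpace I x}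
    (h : ∀ f : C^∞⟮I, M; ℝ⟯, dirDeriv I f x v = 0) : v = 0 := by
  obtain ⟨ψ⟩ : Nonempty (SmoothBumpFunction I x) := inferInstance
  have hs : ContMDiff I 𝓘(ℝ, E) ∞ (fun y => ψ y • extChartAt I x y) :=
    ψ.contMDiff_smul contMDiffOn_extChartAt
  have hd : mfderiv I 𝓘(ℝ, E) (fun y => ψ y • extChartAt I x y) x =
      mfderiv I 𝓘(ℝ, E) (extChartAt I x) x := by
    refine Filter.EventuallyEq.mfderiv_eq ?_
    filter_upwards [ψ.eventuallyEq_one] with y hy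
    rw [hy, Pi.one_apply, one_smul]
  refine (Module.forall_dual_apply_eq_zero_iff ℝ (v : E)).1 fun ℓ => ?_
  let ℓ' : E →L[ℝ] ℝ := LinearMap.toContinuousLinearMap ℓ
  have hℓ : ContMDiff I 𝓘(ℝ, ℝ) ∞ (fun y => ℓ' (ψ y • extChartAt I x y)) :=
    ℓ'.contMDiff.comp hs
  have hc : mfderiv I 𝓘(ℝ, ℝ) (fun y => ℓ' (ψ y • extChartAt I x y)) x v =
      ℓ' (mfderiv I 𝓘(ℝ, E) (fun y => ψ y • extChartAt I x y) x v) := by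
    have h1 := mfderiv_comp x (I := I) (I' := 𝓘(ℝ, E)) (I'' := 𝓘(ℝ, ℝ)) (g := ℓ')
      (f := fun y => ψ y • extChartAt I x y)
      (ℓ'.contMDiff (n := 1).mdifferentiable one_ne_zero _) (hs.mdifferentiable (by simp) x)
    have h2 := congrArg (fun L : TangentSpace I x →L[ℝ] ℝ => L v) h1
    refine h2.trans ?_
    rw [ContinuousLinearMap.mfderiv_eq]
    rfl
  have h3 : dirDeriv I (⟨_, hℓ⟩ : C^∞⟮I, M; ℝ⟯) x v = 0 := h ⟨_, hℓ⟩
  have h4 : mfderiv I 𝓘(ℝ, E) (extChartAt I x) x v = v :=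
    congrArg (fun L : E →L[ℝ] E => L v) mfderiv_extChartAt_self
  have h5 : mfderiv I 𝓘(ℝ, E) (fun y => ψ y • extChartAt I x y) x v = v :=
    (congrArg (fun L : E →L[ℝ] E => L v) hd).trans h4
  exact (congrArg ℓ' h5).symm.trans (hc.symm.trans h3)

end TangentVectors

/-! ### Pairings of bundles and anchors -/

section Pairings

variable {E : Type*} [NormedAddCommGroup E] [NormedSpace ℝ E]
  {H : Type*} [TopologicalSpace H] {I : ModelWithCorners ℝ E H}
  {M : Type*} [TopologicalSpace M] [ChartedSpace H M]
  {F : Type*} [NormedAddCommGroup F] [NormedSpace ℝ F]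
  {V : M → Type*} [TopologicalSpace (TotalSpace F V)] [∀ x, AddCommGroup (V x)]
  [∀ x, Module ℝ (V x)] [∀ x, TopologicalSpace (V x)] [FiberBundle F V] [VectorBundle ℝ F V]
  {F' : Type*} [NormedAddCommGroup F'] [NormedSpace ℝ F']
  {W : M → Type*} [TopologicalSpace (TotalSpace F' W)] [∀ x, AddCommGroup (W x)]
  [∀ x, Module ℝ (W x)] [∀ x, TopologicalSpace (W x)] [FiberBundle F' W] [VectorBundle ℝ F' W]

namespace BundlePairing

theorem pair_neg_right (P : BundlePairing I F V F' W) (s : Cₛ^∞⟮I; F, V⟯) (t : Cₛ^∞⟮I; F', W⟯) :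
    P.pair s (-t) = -P.pair s t := by
  ext x
  exact map_neg (P.toFun x (s x)) (t x)

theorem pair_zero_left (P : BundlePairing I F V F' W) (t : Cₛ^∞⟮I; F', W⟯) :
    P.pair 0 t = 0 := by
  ext x
  exact LinearMap.map_zero₂ (P.toFun x) (t x)

theorem pair_zero_right (P : BundlePairing I F V F' W) (s : Cₛ^∞⟮I; F, V⟯) :
    P.pair s 0 = 0 := by
  ext x
  exact map_zero (P.toFun x (s x))

/-- The pairing with the two bundles in the other order. -/
def flip (P : BundlePairing I F V F' W) : BundlePairing I F' W F V where
  toFun x := (P.toFun x).flip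
  smooth s t := P.smooth t s
  perfect x := (P.perfect x).flip

variable [FiniteDimensional ℝ E] [IsManifold I ∞ M] [T2Space M]
  [FiniteDimensional ℝ F] [ContMDiffVectorBundle ∞ F V I]
  [FiniteDimensional ℝ F'] [ContMDiffVectorBundle ∞ F' W I]

theorem section_ext_right (P : BundlePairing I F V F' W) {t t' : Cₛ^∞⟮I; F', W⟯}
    (h : ∀ s, P.pair s t = P.pair s t') : t = t' :=
  P.flip.section_ext h

end BundlePairing

theorem Anchor.act_neg_left [IsManifold I ∞ M] (a : Anchor I F V) (X : Cₛ^∞⟮I; F, V⟯)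
    (f : C^∞⟮I, M; ℝ⟯) : a.act (-X) f = -a.act X f := by
  rw [← neg_one_smul ℝ X, act_const_smul_left, neg_one_smul]

theorem Anchor.act_zero_right [IsManifold I ∞ M] (a : Anchor I F V) (X : Cₛ^∞⟮I; F, V⟯) :
    a.act X 0 = 0 := by
  simpa using a.act_const_smul_right X 0 0

end Pairings

/-! ### The matched pair conditions -/

section MatchedPairs

variable {E : Type*} [NormedAddCommGroup E] [NormedSpace ℝ E] [FiniteDimensional ℝ E]
  {H : Type*} [TopologicalSpace H] {I : ModelWithCorners ℝ E H}
  {M : Type*} [TopologicalSpace M] [ChartedSpace H M] [IsManifold I ∞ M] [T2Space M]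
  {F : Type*} [NormedAddCommGroup F] [NormedSpace ℝ F] [FiniteDimensional ℝ F]
  {V : M → Type*} [TopologicalSpace (TotalSpace F V)] [∀ x, AddCommGroup (V x)]
  [∀ x, Module ℝ (V x)] [∀ x, TopologicalSpace (V x)] [FiberBundle F V] [VectorBundle ℝ F V]
  [ContMDiffVectorBundle ∞ F V I]
  {F' : Type*} [NormedAddCommGroup F'] [NormedSpace ℝ F'] [FiniteDimensional ℝ F']
  {W : M → Type*} [TopologicalSpace (TotalSpace F' W)] [∀ x, AddCommGroup (W x)]
  [∀ x, Module ℝ (W x)] [∀ x, TopologicalSpace (W x)] [FiberBundle F' W] [VectorBundle ℝ F' W]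
  [ContMDiffVectorBundle ∞ F' W I]
  (A : LieAlgebroid I F V) (B : LieAlgebroid I F' W)
  (ρ : A.Representation F' W) (σ : B.Representation F V)

/-- The failure of the operators `ρ_X` to satisfy the matched pair condition for the bracket of
`B`. By symmetry, `derivDefect B A σ ρ` is the failure of the condition for the bracket of `A`. -/
def derivDefect (X : Cₛ^∞⟮I; F, V⟯) (Y₁ Y₂ : Cₛ^∞⟮I; F', W⟯) : Cₛ^∞⟮I; F', W⟯ :=
  ρ.toFun X (B.bracket Y₁ Y₂) - B.bracket (ρ.toFun X Y₁) Y₂ - B.bracket Y₁ (ρ.toFun X Y₂)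
    - ρ.toFun (σ.toFun Y₂ X) Y₁ + ρ.toFun (σ.toFun Y₁ X) Y₂

/-- The failure of the matched pair condition on the anchors, as a derivation of functions: the
vector field `a(σ_Y X) - b(ρ_X Y) - [b(Y), a(X)]` applied to `f`. -/
def anchorDefect (X : Cₛ^∞⟮I; F, V⟯) (Y : Cₛ^∞⟮I; F', W⟯) (f : C^∞⟮I, M; ℝ⟯) : C^∞⟮I, M; ℝ⟯ :=
  A.act (σ.toFun Y X) f - B.act (ρ.toFun X Y) f - B.act Y (A.act X f) + A.act X (B.act Y f)

/-- The second order terms combine to the derivative along the bracket `[b(Y), a(X)]`. -/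
theorem anchorDefect_apply (X : Cₛ^∞⟮I; F, V⟯) (Y : Cₛ^∞⟮I; F', W⟯) (f : C^∞⟮I, M; ℝ⟯) (x : M) :
    anchorDefect A B ρ σ X Y f x = dirDeriv I f x
      (A.field (σ.toFun Y X) x - B.field (ρ.toFun X Y) x -
        VectorField.mlieBracket I (B.field Y) (A.field X) x) := by
  have : CompleteSpace E := FiniteDimensional.complete ℝ E
  rw [sub_eq_add_neg, dirDeriv_add_right, dirDeriv_neg_right, sub_eq_add_neg, dirDeriv_add_right,
    dirDeriv_neg_right, dirDeriv_mlieBracket f.contMDiff (B.field Y).contMDiff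
    (A.field X).contMDiff]
  show A.act (σ.toFun Y X) f x - B.act (ρ.toFun X Y) f x - B.act Y (A.act X f) x
    + A.act X (B.act Y f) x = A.act (σ.toFun Y X) f x + -B.act (ρ.toFun X Y) f x
    + -(B.act Y (A.act X f) x - A.act X (B.act Y f) x)
  ring

theorem sub_sub_sub_add_eq_zero_iff {G : Type*} [AddCommGroup G] (a b c d e : G) :
    a - b - c - d + e = 0 ↔ a = b + c + d - e := by
  rw [← sub_eq_zero (a := a) (b := b + c + d - e)]
  exact iff_of_eq (congrArg (· = 0) (by abel))

theorem isMatchedPair_iff_defects : IsMatchedPair A B ρ σ ↔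
    (∀ X Y₁ Y₂, derivDefect A B ρ σ X Y₁ Y₂ = 0) ∧
    (∀ Y X₁ X₂, derivDefect B A σ ρ Y X₁ X₂ = 0) ∧
    ∀ X Y f, anchorDefect A B ρ σ X Y f = 0 := by
  constructor
  · intro h
    refine ⟨fun X Y₁ Y₂ => (sub_sub_sub_add_eq_zero_iff _ _ _ _ _).2 (h.left X Y₁ Y₂),
      fun Y X₁ X₂ => (sub_sub_sub_add_eq_zero_iff _ _ _ _ _).2 (h.right Y X₁ X₂), fun X Y f => ?_⟩
    ext x
    rw [anchorDefect_apply, h.anchors X Y x, sub_self]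
    exact map_zero (mfderiv I 𝓘(ℝ, ℝ) f x)
  · rintro ⟨h₁, h₂, h₃⟩
    refine ⟨fun X Y₁ Y₂ => (sub_sub_sub_add_eq_zero_iff _ _ _ _ _).1 (h₁ X Y₁ Y₂),
      fun Y X₁ X₂ => (sub_sub_sub_add_eq_zero_iff _ _ _ _ _).1 (h₂ Y X₁ X₂), fun X Y x => ?_⟩
    refine sub_eq_zero.1 (eq_zero_of_dirDeriv_eq_zero fun f => ?_)
    rw [← anchorDefect_apply, h₃]
    rfl

theorem LieAlgebroid.bracket_smul_left (L : LieAlgebroid I F V) (f : C^∞⟮I, M; ℝ⟯)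
    (X Y : Cₛ^∞⟮I; F, V⟯) :
    L.bracket (f • X) Y = f • L.bracket X Y - L.act Y f • X := by
  refine dualPairing.section_ext_right fun φ => ?_
  rw [L.bracket_swap Y, L.leibniz, L.bracket_swap X, neg_add, ← sub_eq_add_neg]
  ext x
  simp [dualPairing]

/-- The matched pair condition on `ρ` is not linear over functions in `Y₁`; its deviation from
linearity is the anchor defect. -/
theorem derivDefect_smul (f : C^∞⟮I, M; ℝ⟯) (X : Cₛ^∞⟮I; F, V⟯) (Y₁ Y₂ : Cₛ^∞⟮I; F', W⟯) :
    derivDefect A B ρ σ X (f • Y₁) Y₂ =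
      f • derivDefect A B ρ σ X Y₁ Y₂ - anchorDefect A B ρ σ X Y₂ f • Y₁ := by
  refine dualPairing.section_ext_right fun ψ => ?_
  simp only [derivDefect, anchorDefect, B.bracket_smul_left, ρ.leibniz, ρ.smul_left, σ.smul_left,
    map_add, map_sub, LinearMap.add_apply, BundlePairing.pair_sub_right,
    BundlePairing.pair_add_right, BundlePairing.pair_smul_right]
  ring

theorem anchorDefect_add_right (X : Cₛ^∞⟮I; F, V⟯) (Y Y' : Cₛ^∞⟮I; F', W⟯) (f : C^∞⟮I, M; ℝ⟯) :
    anchorDefect A B ρ σ X (Y + Y') f =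
      anchorDefect A B ρ σ X Y f + anchorDefect A B ρ σ X Y' f := by
  simp only [anchorDefect, map_add, LinearMap.add_apply, Anchor.act_add_left,
    Anchor.act_add_right]
  ring

theorem anchorDefect_smul_right (g : C^∞⟮I, M; ℝ⟯) (X : Cₛ^∞⟮I; F, V⟯) (Y : Cₛ^∞⟮I; F', W⟯)
    (f : C^∞⟮I, M; ℝ⟯) :
    anchorDefect A B ρ σ X (g • Y) f = g * anchorDefect A B ρ σ X Y f := by
  simp only [anchorDefect, σ.smul_left, ρ.leibniz, Anchor.act_add_left, Anchor.act_smul_left,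
    Anchor.act_mul_right]
  ring

/-- The condition on `ρ` alone implies that on the anchors. Comparing it for `Y` and `f • Y` gives
`anchorDefect X Y f • Y = 0`, so the anchor defect vanishes where `Y` does not; it vanishes where
`Y` does because it is linear over functions in `Y`. -/
theorem anchorDefect_eq_zero (h : ∀ X Y₁ Y₂, derivDefect A B ρ σ X Y₁ Y₂ = 0)
    (X : Cₛ^∞⟮I; F, V⟯) (Y : Cₛ^∞⟮I; F', W⟯) (f : C^∞⟮I, M; ℝ⟯) :
    anchorDefect A B ρ σ X Y f = 0 := by
  have h₁ : anchorDefect A B ρ σ X Y f • Y = 0 := by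
    have := derivDefect_smul A B ρ σ f X Y Y
    rw [h, h] at this
    refine ContMDiffSection.ext fun x => ?_
    have hx := congrArg (fun s : Cₛ^∞⟮I; F', W⟯ => s x) this
    have hx' : (0 : W x) = f x • (0 : W x) - anchorDefect A B ρ σ X Y f x • Y x := hx
    rw [smul_zero, zero_sub] at hx'
    exact neg_eq_zero.1 hx'.symm
  ext x
  obtain ⟨φ, hφ⟩ := exists_fibre_functional
    (Φ := fun s => anchorDefect A B ρ σ X s f) (fun s t => anchorDefect_add_right A B ρ σ X s t f)
    (fun g s => anchorDefect_smul_right A B ρ σ g X s f) x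
  have hx : anchorDefect A B ρ σ X Y f x • Y x = 0 :=
    congrArg (fun s : Cₛ^∞⟮I; F', W⟯ => s x) h₁
  rcases smul_eq_zero.1 hx with h0 | h0
  · exact h0
  · exact (hφ Y).symm.trans (by rw [h0, map_zero]; rfl)


/-! ### The bialgebroid condition in components -/

theorem pair_sdpPairing (u : Cₛ^∞⟮I; F × (F' →L[ℝ] ℝ), V ×ᵇ (fun x => W x →L[ℝ] ℝ)⟯)
    (ξ : Cₛ^∞⟮I; (F →L[ℝ] ℝ) × F', (fun x => V x →L[ℝ] ℝ) ×ᵇ W⟯) :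
    sdpPairing.pair u ξ = dualPairing.pair (fstSection ξ) (fstSection u) -
      dualPairing.pair (sndSection u) (sndSection ξ) := rfl

theorem act_semidirect {R : A.Representation F' W} (u : Cₛ^∞⟮I; F × F', V ×ᵇ W⟯)
    (f : C^∞⟮I, M; ℝ⟯) : (A.semidirect R).act u f = A.act (fstSection u) f := rfl

theorem act_opposite_semidirectRight {R : B.Representation F V} (ξ : Cₛ^∞⟮I; F × F', V ×ᵇ W⟯)
    (f : C^∞⟮I, M; ℝ⟯) :
    (B.semidirectRight R).opposite.act ξ f = -B.act (sndSection ξ) f := by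
  ext x
  exact dirDeriv_neg_right _ _ _

theorem bracket_opposite_semidirectRight {R : B.Representation F V}
    (ξ η : Cₛ^∞⟮I; F × F', V ×ᵇ W⟯) :
    (B.semidirectRight R).opposite.bracket ξ η =
      mkSection (R.toFun (sndSection η) (fstSection ξ) - R.toFun (sndSection ξ) (fstSection η))
        (B.bracket (sndSection η) (sndSection ξ)) :=
  B.opposite_semidirectRight_bracket R (sndSection ξ) (sndSection η) (fstSection ξ) (fstSection η)

theorem pair_contragredient (R : A.Representation F' W) (X : Cₛ^∞⟮I; F, V⟯)
    (ψ : Cₛ^∞⟮I; F' →L[ℝ] ℝ, fun x => W x →L[ℝ] ℝ⟯) (Y : Cₛ^∞⟮I; F', W⟯) :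
    dualPairing.pair (R.contragredient.toFun X ψ) Y =
      A.act X (dualPairing.pair ψ Y) - dualPairing.pair ψ (R.toFun X Y) :=
  R.pair_contragredientFun X ψ Y

/-- The differential of `A ⋉ B*` in components. On `φ ∈ ΓA*` it is the differential of `A`, and on
`Y ∈ ΓB` it is the form pairing `X` with `ψ` to `-⟨ψ, ρ_X Y⟩`. -/
theorem d_semidirect (ξ : Cₛ^∞⟮I; (F →L[ℝ] ℝ) × F', (fun x => V x →L[ℝ] ℝ) ×ᵇ W⟯)
    (u v : Cₛ^∞⟮I; F × (F' →L[ℝ] ℝ), V ×ᵇ (fun x => W x →L[ℝ] ℝ)⟯) :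
    ((A.semidirect ρ.contragredient).d sdpPairing ξ).toFun u v =
      A.act (fstSection u) (dualPairing.pair (fstSection ξ) (fstSection v))
      - A.act (fstSection v) (dualPairing.pair (fstSection ξ) (fstSection u))
      - dualPairing.pair (fstSection ξ) (A.bracket (fstSection u) (fstSection v))
      - dualPairing.pair (sndSection v) (ρ.toFun (fstSection u) (sndSection ξ))
      + dualPairing.pair (sndSection u) (ρ.toFun (fstSection v) (sndSection ξ)) := by
  have h : sdpPairing.pair ((A.semidirect ρ.contragredient).bracket u v) ξ =
      dualPairing.pair (fstSection ξ) (A.bracket (fstSection u) (fstSection v))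
      - dualPairing.pair (ρ.contragredient.toFun (fstSection u) (sndSection v) -
        ρ.contragredient.toFun (fstSection v) (sndSection u)) (sndSection ξ) := rfl
  show (A.semidirect ρ.contragredient).act u (sdpPairing.pair v ξ) -
    (A.semidirect ρ.contragredient).act v (sdpPairing.pair u ξ) -
      sdpPairing.pair ((A.semidirect ρ.contragredient).bracket u v) ξ = _
  rw [h]
  simp only [act_semidirect, pair_sdpPairing, Anchor.act_sub_right, BundlePairing.pair_sub_left,
    pair_contragredient]
  ring

/-- The `A`-component of the Lie derivative along `φ ⊕ Y` is `-σ_Y`. -/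
theorem fstSection_lieDeriv (ξ : Cₛ^∞⟮I; (F →L[ℝ] ℝ) × F', (fun x => V x →L[ℝ] ℝ) ×ᵇ W⟯)
    (u : Cₛ^∞⟮I; F × (F' →L[ℝ] ℝ), V ×ᵇ (fun x => W x →L[ℝ] ℝ)⟯) :
    fstSection ((B.semidirectRight σ.contragredient).opposite.lieDeriv sdpPairing ξ u) =
      -σ.toFun (sndSection ξ) (fstSection u) := by
  refine dualPairing.section_ext_right fun φ => ?_
  have h := (B.semidirectRight σ.contragredient).opposite.pair_lieDeriv sdpPairing ξ
    (mkSection φ 0) u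
  simp only [pair_sdpPairing, act_opposite_semidirectRight, bracket_opposite_semidirectRight,
    fstSection_mk, sndSection_mk, LinearMap.map_zero, LinearMap.zero_apply, pair_contragredient,
    BundlePairing.pair_sub_left, BundlePairing.pair_zero_right, BundlePairing.pair_zero_left,
    BundlePairing.pair_neg_right, sub_zero] at h ⊢
  rw [h]
  ring

/-- The `B*`-component of the Lie derivative along `φ ⊕ Y`. -/
theorem pair_sndSection_lieDeriv (ξ : Cₛ^∞⟮I; (F →L[ℝ] ℝ) × F', (fun x => V x →L[ℝ] ℝ) ×ᵇ W⟯)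
    (u : Cₛ^∞⟮I; F × (F' →L[ℝ] ℝ), V ×ᵇ (fun x => W x →L[ℝ] ℝ)⟯) (Y : Cₛ^∞⟮I; F', W⟯) :
    dualPairing.pair (sndSection
        ((B.semidirectRight σ.contragredient).opposite.lieDeriv sdpPairing ξ u)) Y =
      -B.act (sndSection ξ) (dualPairing.pair (sndSection u) Y)
      + dualPairing.pair (sndSection u) (B.bracket (sndSection ξ) Y)
      + B.act Y (dualPairing.pair (fstSection ξ) (fstSection u))
      - dualPairing.pair (fstSection ξ) (σ.toFun Y (fstSection u)) := by
  have h := (B.semidirectRight σ.contragredient).opposite.pair_lieDeriv sdpPairing ξ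
    (mkSection 0 Y) u
  simp only [pair_sdpPairing, act_opposite_semidirectRight, bracket_opposite_semidirectRight,
    fstSection_mk, sndSection_mk, LinearMap.map_zero, sub_zero, pair_contragredient, zero_sub,
    BundlePairing.pair_zero_left, B.bracket_swap (sndSection ξ) Y,
    BundlePairing.pair_neg_right, Anchor.act_neg_right] at h
  rw [neg_eq_iff_eq_neg.1 h]
  ring

/-- The contribution of `φ ∈ ΓA*` and `Y ∈ ΓB` to the failure of the bialgebroid condition. -/
def mixedDefect (φ : Cₛ^∞⟮I; F →L[ℝ] ℝ, fun x => V x →L[ℝ] ℝ⟯) (Y : Cₛ^∞⟮I; F', W⟯)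
    (X₁ X₂ : Cₛ^∞⟮I; F, V⟯) : C^∞⟮I, M; ℝ⟯ :=
  dualPairing.pair φ (derivDefect B A σ ρ Y X₁ X₂)
    + anchorDefect A B ρ σ X₁ Y (dualPairing.pair φ X₂)
    - anchorDefect A B ρ σ X₂ Y (dualPairing.pair φ X₁)

/-- The failure of the bialgebroid condition, expressed through the failure of the three matched
pair conditions. -/
theorem bialgebroid_defect
    (ξ η : Cₛ^∞⟮I; (F →L[ℝ] ℝ) × F', (fun x => V x →L[ℝ] ℝ) ×ᵇ W⟯)
    (u v : Cₛ^∞⟮I; F × (F' →L[ℝ] ℝ), V ×ᵇ (fun x => W x →L[ℝ] ℝ)⟯) :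
    ((A.semidirect ρ.contragredient).d sdpPairing
        ((B.semidirectRight σ.contragredient).opposite.bracket ξ η)).toFun u v =
      (-(B.semidirectRight σ.contragredient).opposite.schouten sdpPairing η
          ((A.semidirect ρ.contragredient).d sdpPairing ξ) +
        (B.semidirectRight σ.contragredient).opposite.schouten sdpPairing ξ
          ((A.semidirect ρ.contragredient).d sdpPairing η)).toFun u v
      + dualPairing.pair (sndSection v)
          (derivDefect A B ρ σ (fstSection u) (sndSection ξ) (sndSection η))
      - dualPairing.pair (sndSection u)
          (derivDefect A B ρ σ (fstSection v) (sndSection ξ) (sndSection η))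
      + mixedDefect A B ρ σ (fstSection ξ) (sndSection η) (fstSection u) (fstSection v)
      - mixedDefect A B ρ σ (fstSection η) (sndSection ξ) (fstSection u) (fstSection v) := by
  have hs : ∀ ζ κ, ((B.semidirectRight σ.contragredient).opposite.schouten sdpPairing ζ κ).toFun u v
      = (B.semidirectRight σ.contragredient).opposite.act ζ (κ.toFun u v)
      - κ.toFun ((B.semidirectRight σ.contragredient).opposite.lieDeriv sdpPairing ζ u) v
      - κ.toFun u ((B.semidirectRight σ.contragredient).opposite.lieDeriv sdpPairing ζ v) :=
    fun _ _ => rfl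
  have ha : ∀ κ θ : TwoForm I (F × (F' →L[ℝ] ℝ)) (V ×ᵇ (fun x => W x →L[ℝ] ℝ)),
      (-κ + θ).toFun u v = -κ.toFun u v + θ.toFun u v := fun _ _ => rfl
  rw [ha, hs, hs]
  simp only [d_semidirect, fstSection_lieDeriv, pair_sndSection_lieDeriv,
    act_opposite_semidirectRight, bracket_opposite_semidirectRight, fstSection_mk, sndSection_mk,
    mixedDefect, derivDefect, anchorDefect, pair_contragredient, BundlePairing.pair_sub_left,
    BundlePairing.pair_add_right, BundlePairing.pair_sub_right, BundlePairing.pair_neg_right,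
    Anchor.act_add_right, Anchor.act_sub_right, Anchor.act_neg_left, map_neg,
    LinearMap.neg_apply, B.bracket_swap (sndSection ξ) (sndSection η)]
  rw [B.bracket_swap (ρ.toFun (fstSection u) (sndSection ξ)) (sndSection η),
   B.bracket_swap (ρ.toFun (fstSection v) (sndSection ξ)) (sndSection η)]
  simp only [BundlePairing.pair_neg_right, Anchor.act_neg_right]
  ring

theorem mixedDefect_zero_left (Y : Cₛ^∞⟮I; F', W⟯) (X₁ X₂ : Cₛ^∞⟮I; F, V⟯) :
    mixedDefect A B ρ σ 0 Y X₁ X₂ = 0 := by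
  simp only [mixedDefect, anchorDefect, BundlePairing.pair_zero_left, Anchor.act_zero_right]
  ring

/-- Sections of the form `φ ⊕ 0` and `0 ⊕ Y` isolate the components of the bialgebroid defect. -/
theorem isLieBialgebroid_iff_defects :
    IsLieBialgebroid (A.semidirect ρ.contragredient)
      (B.semidirectRight σ.contragredient).opposite sdpPairing ↔
    (∀ X Y₁ Y₂, derivDefect A B ρ σ X Y₁ Y₂ = 0) ∧
    ∀ φ Y X₁ X₂, mixedDefect A B ρ σ φ Y X₁ X₂ = 0 := by
  constructor
  · intro h
    have key := fun ξ η u v => (bialgebroid_defect A B ρ σ ξ η u v).symm.trans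
      (congrArg (fun κ => TwoForm.toFun κ u v) (h ξ η))
    have h₁ : ∀ X Y₁ Y₂, derivDefect A B ρ σ X Y₁ Y₂ = 0 := by
      refine fun X Y₁ Y₂ => dualPairing.section_ext_right fun ψ => ?_
      have k := key (mkSection 0 Y₁) (mkSection 0 Y₂) (mkSection X 0) (mkSection 0 ψ)
      simp only [fstSection_mk, sndSection_mk, mixedDefect_zero_left,
        BundlePairing.pair_zero_left] at k
      rw [BundlePairing.pair_zero_right]
      linear_combination k
    refine ⟨h₁, fun φ Y X₁ X₂ => ?_⟩
    have k := key (mkSection φ 0) (mkSection 0 Y) (mkSection X₁ 0) (mkSection X₂ 0)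
    simp only [fstSection_mk, sndSection_mk, mixedDefect_zero_left,
      BundlePairing.pair_zero_left] at k
    linear_combination k
  · rintro ⟨h₁, h₂⟩ ξ η
    refine TwoForm.ext (funext fun u => funext fun v => ?_)
    rw [bialgebroid_defect, h₁, h₁, h₂, h₂, BundlePairing.pair_zero_right,
      BundlePairing.pair_zero_right]
    ring

end MatchedPairs

end LieAlgebroids

end

theorem mainTheorem3 {E : Type*} [NormedAddCommGroup E] [NormedSpace ℝ E] [FiniteDimensional ℝ E]
    {H : Type*} [TopologicalSpace H] {I : ModelWithCorners ℝ E H}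
    {M : Type*} [TopologicalSpace M] [ChartedSpace H M] [IsManifold I ∞ M] [T2Space M]
    {F : Type*} [NormedAddCommGroup F] [NormedSpace ℝ F] [FiniteDimensional ℝ F]
    {V : M → Type*} [TopologicalSpace (TotalSpace F V)] [∀ x, AddCommGroup (V x)]
    [∀ x, Module ℝ (V x)] [∀ x, TopologicalSpace (V x)] [FiberBundle F V] [VectorBundle ℝ F V]
    [ContMDiffVectorBundle ∞ F V I]
    {F' : Type*} [NormedAddCommGroup F'] [NormedSpace ℝ F'] [FiniteDimensional ℝ F']
    {W : M → Type*} [TopologicalSpace (TotalSpace F' W)] [∀ x, AddCommGroup (W x)]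
    [∀ x, Module ℝ (W x)] [∀ x, TopologicalSpace (W x)] [FiberBundle F' W] [VectorBundle ℝ F' W]
    [ContMDiffVectorBundle ∞ F' W I]
    (A : LieAlgebroids.LieAlgebroid I F V) (B : LieAlgebroids.LieAlgebroid I F' W)
    (ρ : A.Representation F' W) (σ : B.Representation F V) :
    LieAlgebroids.IsMatchedPair A B ρ σ ↔
      LieAlgebroids.IsLieBialgebroid (A.semidirect ρ.contragredient)
        (B.semidirectRight σ.contragredient).opposite
        LieAlgebroids.sdpPairing := by
  rw [LieAlgebroids.isMatchedPair_iff_defects, LieAlgebroids.isLieBialgebroid_iff_defects]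
  refine and_congr_right fun h => ?_
  have hθ := LieAlgebroids.anchorDefect_eq_zero A B ρ σ h
  simp only [LieAlgebroids.mixedDefect, hθ, add_zero, sub_zero, implies_true, and_true]
  constructor
  · intro h₂ φ Y X₁ X₂
    rw [h₂, LieAlgebroids.BundlePairing.pair_zero_right]
  · intro h₂ Y X₁ X₂
    refine LieAlgebroids.dualPairing.section_ext_right fun φ => ?_
    rw [h₂, LieAlgebroids.BundlePairing.pair_zero_right]
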